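/- For a directed graph $G=(V,E)$, $E\subseteq V\times V$, a set $\mathcal P\subseteq V\times V$ of vertex pairs and an integer $k\ge 0$, a $k$-fault-tolerant reachability subgraph $k\text{-}\mathrm{FTRS}(G,\mathcal P)$ is a subgraph $H$ of $G$ with vertex set $V$ such that for every pair $(s,t)\in\mathcal P$ and every set $F\subseteq E$ of at most $k$ edges, $t$ is reachable from $s$ in $G\setminus F$ if and only if $t$ is reachable from $s$ in $H\setminus F$. **Theorem (Upper bound on 2-FTRS).** There is an absolute constant $C$ such that for every directed graph $G=(V,E)$ with $n=|V|<\infty$ vertices and every set $\mathcal P\subseteq V\times V$ there is a $2\text{-}\mathrm{FTRS}(G,\mathcal P)$ with at most $C\,n^{4/3}\,|\mathcal P|^{1/3}$ edges. Furthermore, such a subgraph can be found in polynomial time: there is one deterministic algorithm (a random access machine program with addition, truncated subtraction, indirect loads and stores, branches and loops, each elementary instruction and each test costing one step) which, given $n$, the adjacency matrix of a directed graph $G$ on the vertex set $\{0,\dots,n-1\}$ and the $0/1$ matrix of a set $\mathcal P$ of vertex pairs, halts after a number of steps bounded by a fixed polynomial in the input length $2n^2+1$ and outputs the adjacency matrix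 of a $2\text{-}\mathrm{FTRS}(G,\mathcal P)$ with at most $C\,n^{4/3}\,|\mathcal P|^{1/3}$ edges. -/

import Mathlib

/-! ### Directed graphs and fault-tolerant reachability subgraphs -/

namespace FaultTolerant

/-- The edge set of a directed graph, as a set of ordered pairs of vertices. -/
def edges {V : Type*} (G : Digraph V) : Set (V × V) :=
  {e | G.Adj e.1 e.2}

/-- The graph `G \ F`: delete the edges in `F`, keep all the vertices. -/
def deleteEdges {V : Type*} (G : Digraph V) (F : Set (V × V)) : Digraph V :=
  ⟨fun u v => G.Adj u v ∧ (u, v) ∉ F⟩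

/-- `t` is reachable from `s` by a directed path (of length at least `0`) in `G`. -/
def Reachable {V : Type*} (G : Digraph V) (s t : V) : Prop :=
  Relation.ReflTransGen G.Adj s t

/-- `H` is a `k`-fault-tolerant reachability subgraph of `G` for the set `P` of vertex pairs.
The relation `H ≤ G` says that `H` is a (spanning) subgraph of `G`. -/
def IsFTRS {V : Type*} (k : ℕ) (G : Digraph V) (P : Set (V × V)) (H : Digraph V) : Prop :=
  H ≤ G ∧
    ∀ s t : V, (s, t) ∈ P → ∀ F : Set (V × V), F ⊆ edges G → F.encard ≤ k →
      (Reachable (deleteEdges G F) s t ↔ Reachable (deleteEdges H F) s t)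

end FaultTolerant

/-! ### Random access machine programs and polynomial time

The machine has registers and a random access memory, all holding natural numbers. Programs are
structured, and every elementary instruction and every test of a condition takes one step.
The arithmetic is addition and truncated subtraction only. Hence in `T` steps the bit length of the
largest number grows by at most `T` plus a constant that depends on the program, and polynomial
time here is the usual polynomial time (of Turing machines). -/

namespace RAM

/-- Programs. The arguments `x`, `y`, `z` are names of registers. -/
inductive Prog : Type
  /-- `x := c` for a constant `c` -/
  | const (x c : ℕ)
  /-- `x := y` -/
  | copy (x y : ℕ)
  /-- `x := y + z` -/
  | add (x y z : ℕ)
  /-- `x := y - z`, or `0` if `y < z` -/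
  | sub (x y z : ℕ)
  /-- `x := mem[y]` -/
  | load (x y : ℕ)
  /-- `mem[x] := y` -/
  | store (x y : ℕ)
  /-- first `p`, then `q` -/
  | seq (p q : Prog)
  /-- if `x ≠ 0` then `p` else `q` -/
  | ite (x : ℕ) (p q : Prog)
  /-- while `x ≠ 0` do `p` -/
  | loop (x : ℕ) (p : Prog)

/-- A state of the machine: the contents of the registers and of the memory. -/
structure State : Type where
  reg : ℕ → ℕ
  mem : ℕ → ℕ

/-- Write the value `v` to register `x`. -/
def State.setReg (σ : State) (x v : ℕ) : State :=
  { σ with reg := Function.update σ.reg x v }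

/-- Write the value `v` to the memory cell with address `a`. -/
def State.setMem (σ : State) (a v : ℕ) : State :=
  { σ with mem := Function.update σ.mem a v }

/-- `Exec p σ T τ`: the program `p`, started in the state `σ`, halts after exactly `T` steps in the
state `τ`. -/
inductive Exec : Prog → State → ℕ → State → Prop
  | const (x c : ℕ) (σ : State) : Exec (.const x c) σ 1 (σ.setReg x c)
  | copy (x y : ℕ) (σ : State) : Exec (.copy x y) σ 1 (σ.setReg x (σ.reg y))
  | add (x y z : ℕ) (σ : State) : Exec (.add x y z) σ 1 (σ.setReg x (σ.reg y + σ.reg z))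
  | sub (x y z : ℕ) (σ : State) : Exec (.sub x y z) σ 1 (σ.setReg x (σ.reg y - σ.reg z))
  | load (x y : ℕ) (σ : State) : Exec (.load x y) σ 1 (σ.setReg x (σ.mem (σ.reg y)))
  | store (x y : ℕ) (σ : State) : Exec (.store x y) σ 1 (σ.setMem (σ.reg x) (σ.reg y))
  | seq {p q : Prog} {σ τ ρ : State} {S T : ℕ} :
      Exec p σ S τ → Exec q τ T ρ → Exec (.seq p q) σ (S + T) ρ
  | ite_true {x : ℕ} {p q : Prog} {σ τ : State} {T : ℕ} :
      σ.reg x ≠ 0 → Exec p σ T τ → Exec (.ite x p q) σ (1 + T) τ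
  | ite_false {x : ℕ} {p q : Prog} {σ τ : State} {T : ℕ} :
      σ.reg x = 0 → Exec q σ T τ → Exec (.ite x p q) σ (1 + T) τ
  | loop_true {x : ℕ} {p : Prog} {σ τ ρ : State} {S T : ℕ} :
      σ.reg x ≠ 0 → Exec p σ S τ → Exec (.loop x p) τ T ρ →
        Exec (.loop x p) σ (1 + S + T) ρ
  | loop_false {x : ℕ} {p : Prog} {σ : State} :
      σ.reg x = 0 → Exec (.loop x p) σ 1 σ

/-- The initial state on the input `w`, a finite sequence of numbers: the input is in the memory
from address `0` on, its length is in register `0`, and everything else is `0`. -/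
def initState (w : List ℕ) : State where
  reg := fun x => if x = 0 then w.length else 0
  mem := fun a => w.getD a 0

/-- The output in the state `σ`: the sequence in the memory from address `0` on whose length is in
register `0`. -/
def State.output (σ : State) : List ℕ :=
  (List.range (σ.reg 0)).map σ.mem

/-- The search problem with instances `a : α`, encoded by `encode a`, and with the acceptable
outputs `w` described by `IsSolution a w`, is solved by a program whose number of steps is at most
a polynomial in the length of the input. -/
def SolvableInPolyTime {α : Type*} (encode : α → List ℕ) (IsSolution : α → List ℕ → Prop) : Prop :=
  ∃ (p : Prog) (f : Polynomial ℕ), ∀ a : α, ∃ (T : ℕ) (σ : State),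
    Exec p (initState (encode a)) T σ ∧ T ≤ f.eval (encode a).length ∧ IsSolution a σ.output

end RAM

namespace FaultTolerant

open Classical in
/-- The 0/1 matrix of a binary relation on `{0, …, n - 1}`, written row by row. -/
noncomputable def matrixWord {n : ℕ} (R : Fin n → Fin n → Prop) : List ℕ :=
  List.ofFn fun k : Fin (n * n) => if R k.divNat k.modNat then 1 else 0

/-- An input of the algorithm: a directed graph on the vertices `0, …, n - 1` with a set of vertex
pairs. -/
structure Input : Type where
  n : ℕ
  G : Digraph (Fin n)
  P : Set (Fin n × Fin n)

/-- The encoding of an input: the number `n`, the adjacency matrix of the graph, and the matrix of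
the set of pairs (`2 n² + 1` numbers, each at most `max n 1`). -/
noncomputable def Input.encode (I : Input) : List ℕ :=
  I.n :: (matrixWord I.G.Adj ++ matrixWord fun s t => (s, t) ∈ I.P)

end FaultTolerant

/-! Call an edge `e` of `H` critical if, for some pair `(s, t)` in `P` and some set `F` of at most
two edges, `t` is reachable from `s` in `H \ F` and every such path uses `e`. Deleting an edge that
is not critical preserves the FTRS property, so greedy deletion ends in an FTRS with only critical
edges. What remains is to bound the number of critical edges.

Fix a threshold `D` and choose for every edge a witness `(s, t, F)`. Let `between G s t F` be the
set of vertices on the surviving walks.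

Small witnesses, with at most `D` vertices between: each pair accounts for `O(D²)` edges
(`card_le_of_crit_two`). One surviving path with at most `D` edges must contain every other critical
edge or be hit by its failure set. Fixing the edge that is hit reduces to one failure, where `O(D)`
edges are critical (`card_le_of_crit_one`). That case rests on `not_three_cuts`: three single
failures cannot be pairwise incompatible.

Large witnesses: for each vertex `r`, only `18 n` edges have witnesses with `r` between the
terminals (`card_crit_through_le`), since such an edge is critical from `r` or towards `r`, and with
a fixed source at most nine critical edges enter a vertex (`card_le_of_crit_source`, by
submodularity of cuts). Summing over `r` gives at most `18 n² / D` edges.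

The total `5 D² |P| + 18 n² / D` is balanced at `D ≈ (n² / |P|)^(1/3)`.

For the algorithm, deletion never makes a critical edge noncritical (`CritFor.deleteEdges`), so one
pass over the edges suffices. Each test tries all pairs of failures and all pairs in `P`, with a
reachability search for each. -/

namespace FaultTolerant

/-! ### Critical edges and compatible failure sets -/

section Reachability

variable {V : Type*} {G : Digraph V} {s t u v : V} {F F' : Set (V × V)} {e e' : V × V}

/-- `t` is reachable from `s` in `G \ F`. -/
abbrev Avoid (G : Digraph V) (F : Set (V × V)) (s t : V) : Prop :=
  Reachable (deleteEdges G F) s t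

/-- After the failure of `F`, the edge `e` lies on all paths from `s` to `t`, and there is one. -/
def Crit (G : Digraph V) (e : V × V) (s t : V) (F : Set (V × V)) : Prop :=
  Avoid G F s t ∧ ¬ Avoid G (insert e F) s t

/-- The vertices on the walks from `s` to `t` in `G \ F`. -/
def between (G : Digraph V) (s t : V) (F : Set (V × V)) : Set V :=
  {v | Avoid G F s v ∧ Avoid G F v t}

lemma Reachable.mono {H : Digraph V} (hG : Reachable G s t)
    (h : ∀ u v, G.Adj u v → H.Adj u v) : Reachable H s t :=
  Relation.ReflTransGen.mono h _ _ hG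

lemma Avoid.anti (h : F ⊆ F') (hF : Avoid G F' s t) : Avoid G F s t :=
  Reachable.mono hF fun _ _ huv => ⟨huv.1, fun hm => huv.2 (h hm)⟩

lemma Avoid.trans (h : Avoid G F s t) (h' : Avoid G F t u) : Avoid G F s u :=
  Relation.ReflTransGen.trans h h'

lemma Avoid.single (h : G.Adj e.1 e.2) (he : e ∉ F) : Avoid G F e.1 e.2 :=
  Relation.ReflTransGen.single ⟨h, he⟩

lemma deleteEdges_deleteEdges (F F' : Set (V × V)) :
    deleteEdges (deleteEdges G F) F' = deleteEdges G (F ∪ F') := by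
  ext u v
  simp [deleteEdges, not_or, and_assoc]

/-- A walk that avoids `F` either avoids `X` too, or has a first edge in `X`. -/
lemma Avoid.first (h : Avoid G F s t) (X : Set (V × V)) :
    Avoid G (F ∪ X) s t ∨ ∃ x ∈ X, x ∉ F ∧ G.Adj x.1 x.2 ∧ Avoid G (F ∪ X) s x.1 ∧
      Avoid G F x.2 t := by
  induction h with
  | refl => exact .inl .refl
  | @tail b c _ hbc ih =>
    rcases ih with ih | ⟨x, hx, hxF, hadj, h1, h2⟩
    · by_cases hX : (b, c) ∈ X
      · exact .inr ⟨(b, c), hX, hbc.2, hbc.1, ih, .refl⟩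
      · exact .inl (ih.tail ⟨hbc.1, fun hm => hm.elim hbc.2 hX⟩)
    · exact .inr ⟨x, hx, hxF, hadj, h1, h2.tail hbc⟩

/-- A walk that avoids `F` either avoids `X` too, or has a last edge in `X`. -/
lemma Avoid.last (h : Avoid G F s t) (X : Set (V × V)) :
    Avoid G (F ∪ X) s t ∨ ∃ x ∈ X, x ∉ F ∧ G.Adj x.1 x.2 ∧ Avoid G F s x.1 ∧
      Avoid G (F ∪ X) x.2 t := by
  induction h using Relation.ReflTransGen.head_induction_on with
  | refl => exact .inl .refl
  | @head a b hab _ ih =>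
    rcases ih with ih | ⟨x, hx, hxF, hadj, h1, h2⟩
    · by_cases hX : (a, b) ∈ X
      · exact .inr ⟨(a, b), hX, hab.2, hab.1, .refl, ih⟩
      · exact .inl (ih.head ⟨hab.1, fun hm => hm.elim hab.2 hX⟩)
    · exact .inr ⟨x, hx, hxF, hadj, h1.head hab, h2⟩

/-- A walk that survives `F ∪ F'` must use `e`, since otherwise it survives `insert e F`. It is cut
at its first use of `e`. -/
lemma Crit.through (h : Crit G e s t F) (h' : Avoid G (F ∪ F') s t) :
    e ∉ F ∪ F' ∧ G.Adj e.1 e.2 ∧ Avoid G (F ∪ F' ∪ {e}) s e.1 ∧ Avoid G (F ∪ F') e.2 t := by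
  rcases h'.first {e} with h1 | ⟨x, rfl, hx⟩
  · exact absurd (h1.anti (by rintro x (rfl | hx) <;> simp_all)) h.2
  · exact hx

/-- This confines critical edges: if the failure `F` of `e` is compatible with `F'`, the common
surviving walk passes through `e` and stays in the vertex set of `F'`. -/
lemma Crit.head_mem_between (h : Crit G e s t F) (h' : Avoid G (F ∪ F') s t) :
    e.2 ∈ between G s t F' := by
  obtain ⟨h1, h2, h3, h4⟩ := h.through h'
  exact ⟨((h3.anti Set.subset_union_left).trans (.single h2 h1)).anti Set.subset_union_right,
    h4.anti Set.subset_union_right⟩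

lemma Crit.adj (h : Crit G e s t F) : G.Adj e.1 e.2 :=
  (h.through (F' := ∅) (by simpa using h.1)).2.1

lemma Crit.to_head (h : Crit G e s t F) : Crit G e s e.2 F := by
  refine ⟨(h.head_mem_between (F' := F) (by simpa using h.1)).1, fun h1 => ?_⟩
  rcases h.1.last {e} with h2 | ⟨x, rfl, -, -, -, h2⟩
  · exact h.2 (by simpa [Set.union_comm] using h2)
  · exact h.2 (h1.trans (by simpa [Set.union_comm] using h2))

/-- A walk surviving both failures would use one of the two edges first. As that edge already ends
at `v`, the walk up to there avoids the other edge, which was critical. -/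
lemma Crit.not_avoid_union (h : Crit G e s v F) (h' : Crit G e' s v F') (hne : e ≠ e')
    (he : e.2 = v) (he' : e'.2 = v) : ¬ Avoid G (F ∪ F') s v := by
  intro hR
  rcases hR.first {e, e'} with h1 | ⟨x, rfl | rfl, hxF, hadj, h1, -⟩
  · exact h.2 (h1.anti (by rintro x (rfl | hx) <;> simp_all))
  · refine h'.2 ?_
    rw [← he]
    refine (h1.anti ?_).trans (.single hadj ?_)
    · rintro x (rfl | hx) <;> simp_all
    · rintro (hx | hx)
      · exact hne hx
      · exact hxF (.inr hx)
  · refine h.2 ?_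
    rw [← he']
    refine (h1.anti ?_).trans (.single hadj ?_)
    · rintro x (rfl | hx) <;> simp_all
    · rintro (hx | hx)
      · exact hne hx.symm
      · exact hxF (.inl hx)

/-- Among three sets of at most one edge that do not separate `t` from `s`, there are two whose
union does not separate `t` from `s`. -/
lemma not_three_cuts {F₁ F₂ F₃ : Set (V × V)} (c₁ : F₁.encard ≤ 1) (c₂ : F₂.encard ≤ 1)
    (c₃ : F₃.encard ≤ 1) (h₁ : Avoid G F₁ s t) (h₂ : Avoid G F₂ s t) (h₃ : Avoid G F₃ s t)
    (h₁₂ : ¬ Avoid G (F₁ ∪ F₂) s t) (h₁₃ : ¬ Avoid G (F₁ ∪ F₃) s t)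
    (h₂₃ : ¬ Avoid G (F₂ ∪ F₃) s t) : False := by
  have single : ∀ {A B : Set (V × V)}, A.encard ≤ 1 → Avoid G B s t → ¬ Avoid G (A ∪ B) s t →
      ∃ f, A = {f} := by
    intro A B hA hB hAB
    rcases Set.encard_le_one_iff_eq.1 hA with rfl | hf
    · simp_all
    · exact hf
  obtain ⟨f₁, rfl⟩ := single c₁ h₂ h₁₂
  obtain ⟨f₂, rfl⟩ := single c₂ h₃ h₂₃
  obtain ⟨f₃, rfl⟩ := single c₃ h₁ (by rwa [Set.union_comm])
  have n₁₂ : f₁ ≠ f₂ := by rintro rfl; simp_all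
  have n₁₃ : f₁ ≠ f₃ := by rintro rfl; simp_all
  have n₂₃ : f₂ ≠ f₃ := by rintro rfl; simp_all
  set U : Set (V × V) := {f₁, f₂, f₃} with hU
  -- A walk avoiding `a` must meet `{b, c}`. Its first and last edges in `U` give the part from `s`
  -- and the part to `t` that avoid all of `U`.
  have key : ∀ a b c : V × V, U = {a, b, c} → a ≠ b → a ≠ c → b ≠ c → Avoid G {a} s t →
      ¬ Avoid G ({a} ∪ {b}) s t →
      ((G.Adj b.1 b.2 ∧ Avoid G U s b.1) ∨ (G.Adj c.1 c.2 ∧ Avoid G U s c.1)) ∧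
      (Avoid G U b.2 t ∨ Avoid G U c.2 t) := by
    intro a b c hU' hab hac hbc h hc
    have hX : ({a} : Set (V × V)) ∪ U = U := by rw [hU']; ext; simp; tauto
    constructor
    · rcases h.first U with h1 | ⟨x, hx, hxa, hadj, h1, -⟩
      · exact absurd (h1.anti (by rw [hU']; intro x; simp; tauto)) hc
      · rw [hX] at h1
        rw [hU'] at hx
        rcases hx with rfl | rfl | rfl
        · simp at hxa
        · exact .inl ⟨hadj, h1⟩
        · exact .inr ⟨hadj, h1⟩
    · rcases h.last U with h1 | ⟨x, hx, hxa, hadj, -, h1⟩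
      · exact absurd (h1.anti (by rw [hU']; intro x; simp; tauto)) hc
      · rw [hX] at h1
        rw [hU'] at hx
        rcases hx with rfl | rfl | rfl
        · simp at hxa
        · exact .inl h1
        · exact .inr h1
  have excl : ∀ a b c : V × V, U = {a, b, c} → a ≠ b → a ≠ c →
      ¬ Avoid G ({b} ∪ {c}) s t → (G.Adj a.1 a.2 ∧ Avoid G U s a.1) → ¬ Avoid G U a.2 t := by
    intro a b c hU' hab hac hcut h1 h2
    have hsub : ({b} : Set (V × V)) ∪ {c} ⊆ U := by rw [hU']; intro x; simp; tauto
    exact hcut (((h1.2.anti hsub).trans (.single h1.1 (by simp [hab, hac]))).trans (h2.anti hsub))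
  have p₂ : U = {f₂, f₁, f₃} := Set.insert_comm _ _ _
  have p₃ : U = {f₃, f₁, f₂} := by rw [hU]; ext; simp; tauto
  have k₁ := key f₁ f₂ f₃ hU n₁₂ n₁₃ n₂₃ h₁ h₁₂
  have k₂ := key f₂ f₁ f₃ p₂ n₁₂.symm n₂₃ n₁₃ h₂ (by rwa [Set.union_comm])
  have k₃ := key f₃ f₁ f₂ p₃ n₁₃.symm n₂₃.symm n₁₂ h₃ (by rwa [Set.union_comm])
  have x₁ := excl f₁ f₂ f₃ hU n₁₂ n₁₃ h₂₃
  have x₂ := excl f₂ f₁ f₃ p₂ n₁₂.symm n₂₃ h₁₃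
  have x₃ := excl f₃ f₁ f₂ p₃ n₁₃.symm n₂₃.symm h₁₂
  -- By `key`, every two of the three edges include one whose tail is reached from `s` off `U`, so
  -- at least two edges have this property; likewise at least two have heads that reach `t` off `U`.
  -- Some edge has both, against `excl`.
  clear key excl single
  grind

end Reachability

/-! ### Edges critical for one pair with a small surviving part -/

section Counting

variable {V : Type*} {G : Digraph V} {s t v : V}

lemma card_le_two_of_crit (M : Finset (V × V)) (hv : ∀ e ∈ M, e.2 = v)
    (h : ∀ e ∈ M, ∃ F : Set (V × V), F.encard ≤ 1 ∧ Crit G e s v F) : M.card ≤ 2 := by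
  by_contra! hc
  obtain ⟨a, b, c, ha, hb, hc, hab, hac, hbc⟩ := Finset.two_lt_card_iff.1 hc
  obtain ⟨F₁, c₁, h₁⟩ := h a ha
  obtain ⟨F₂, c₂, h₂⟩ := h b hb
  obtain ⟨F₃, c₃, h₃⟩ := h c hc
  exact not_three_cuts c₁ c₂ c₃ h₁.1 h₂.1 h₃.1
    (h₁.not_avoid_union h₂ hab (hv a ha) (hv b hb))
    (h₁.not_avoid_union h₃ hac (hv a ha) (hv c hc))
    (h₂.not_avoid_union h₃ hbc (hv b hb) (hv c hc))

variable [Fintype V]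

open Classical in
lemma card_le_of_crit_one (D : ℕ) (M : Finset (V × V))
    (h : ∀ e ∈ M, ∃ F : Set (V × V), F.encard ≤ 1 ∧ Crit G e s t F ∧
      (between G s t F).ncard ≤ D) : M.card ≤ 4 * D := by
  rcases M.eq_empty_or_nonempty with rfl | ⟨e₀, he₀⟩
  · simp
  choose! F hF1 hFc hFD using h
  -- If some `F e₁` is incompatible with `F e₀`, then by `not_three_cuts` every `F e` is compatible
  -- with one of these two. So two vertex sets of size at most `D` contain all heads.
  obtain ⟨e₁, he₁, hcov⟩ : ∃ e₁ ∈ M, ∀ e ∈ M,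
      e.2 ∈ between G s t (F e₀) ∪ between G s t (F e₁) := by
    by_cases hbad : ∃ e₁ ∈ M, ¬ Avoid G (F e₁ ∪ F e₀) s t
    · obtain ⟨e₁, he₁, hb⟩ := hbad
      refine ⟨e₁, he₁, fun e he => ?_⟩
      by_cases h0 : Avoid G (F e ∪ F e₀) s t
      · exact .inl ((hFc e he).head_mem_between h0)
      · by_cases h1 : Avoid G (F e ∪ F e₁) s t
        · exact .inr ((hFc e he).head_mem_between h1)
        · exact (not_three_cuts (hF1 e he) (hF1 e₁ he₁) (hF1 e₀ he₀) (hFc e he).1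
            (hFc e₁ he₁).1 (hFc e₀ he₀).1 h1 h0 hb).elim
    · push Not at hbad
      exact ⟨e₀, he₀, fun e he => .inl ((hFc e he).head_mem_between (hbad e he))⟩
  set X := (between G s t (F e₀) ∪ between G s t (F e₁)).toFinset with hX
  have hXc : X.card ≤ 2 * D := by
    rw [hX, ← Set.ncard_eq_toFinset_card']
    have := Set.ncard_union_le (between G s t (F e₀)) (between G s t (F e₁))
    have := hFD e₀ he₀
    have := hFD e₁ he₁
    omega
  have := Finset.card_le_mul_card_image_of_maps_to (s := M) (t := X) (f := Prod.snd)
    (fun e he => by simpa [hX] using hcov e he) 2 (fun v _ => ?_)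
  · omega
  · refine card_le_two_of_crit (G := G) (s := s) (v := v) _ (by simp) fun e he => ?_
    simp only [Finset.mem_filter] at he
    refine ⟨F e, hF1 e he.1, ?_⟩
    rw [← he.2]
    exact (hFc e he.1).to_head

open Classical in
/-- A path with few edges inside the set of vertices between `s` and `t`. -/
lemma exists_small_path {F : Set (V × V)} (h : Avoid G F s t) :
    ∃ Q : Finset (V × V), Q.card ≤ (between G s t F).ncard ∧
      ∀ F' : Set (V × V), (∀ e ∈ Q, e ∉ F') → Avoid G F' s t := by
  let g : Finset (V × V) → Digraph V := fun Q => ⟨fun u v => (u, v) ∈ Q⟩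
  let 𝒬 : Set (Finset (V × V)) :=
    {Q | (∀ e ∈ Q, G.Adj e.1 e.2 ∧ e ∉ F) ∧ Reachable (g Q) s t}
  have hne : 𝒬.Nonempty := by
    refine ⟨Finset.univ.filter fun e => G.Adj e.1 e.2 ∧ e ∉ F, by simp, ?_⟩
    exact Reachable.mono h fun u v huv => by
      simpa [g] using (show G.Adj u v ∧ (u, v) ∉ F from huv)
  -- By minimality every edge of `Q` is critical within `Q` without any failure. Hence no two edges
  -- of `Q` share a head, and the heads lie between `s` and `t`.
  obtain ⟨Q, hQ⟩ := (Set.toFinite 𝒬).exists_minimal hne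
  have hcrit : ∀ e ∈ Q, Crit (g Q) e s t ∅ := by
    intro e he
    refine ⟨Reachable.mono hQ.prop.2 fun u v huv => ⟨huv, by simp⟩, fun hc => ?_⟩
    have hmem : Q.erase e ∈ 𝒬 := by
      refine ⟨fun x hx => hQ.prop.1 x (Finset.mem_of_mem_erase hx), ?_⟩
      exact Reachable.mono hc fun u v huv =>
        Finset.mem_erase.2 ⟨fun hh => huv.2 (by simp [hh]), huv.1⟩
    exact Finset.notMem_erase e Q (hQ.le_of_le hmem (Finset.erase_subset _ _) he)
  refine ⟨Q, ?_, fun F' hF' => ?_⟩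
  · rw [Set.ncard_eq_toFinset_card']
    refine Finset.card_le_card_of_injOn Prod.snd (fun e he => ?_) fun e he e' he' hee => ?_
    · have := (hcrit e he).head_mem_between (F' := ∅) (by simpa using (hcrit e he).1)
      have tr : ∀ {a b : V}, Avoid (g Q) ∅ a b → Avoid G F a b := fun hab =>
        Reachable.mono hab fun u v huv => hQ.prop.1 (u, v) huv.1
      simpa using (show e.2 ∈ between G s t F from ⟨tr this.1, tr this.2⟩)
    · by_contra hne
      have h1 := (hcrit e he).to_head
      have h2 := (hcrit e' he').to_head
      rw [← hee] at h2
      exact h1.not_avoid_union h2 hne rfl hee.symm (by simpa using h1.1)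
  · exact Reachable.mono hQ.prop.2 fun u v huv => ⟨(hQ.prop.1 (u, v) huv).1, hF' _ huv⟩

open Classical in
lemma card_le_of_crit_two (D : ℕ) (M : Finset (V × V))
    (h : ∀ e ∈ M, ∃ F : Set (V × V), F.encard ≤ 2 ∧ Crit G e s t F ∧
      (between G s t F).ncard ≤ D) : M.card ≤ D + D * (4 * D) := by
  rcases M.eq_empty_or_nonempty with rfl | ⟨e₀, he₀⟩
  · simp
  choose! F hF2 hFc hFD using h
  obtain ⟨Q, hQc, hQ⟩ := exists_small_path (hFc e₀ he₀).1
  have hQD := hQc.trans (hFD e₀ he₀)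
  -- If `e` is not in `Q` and `F e` misses `Q`, then the path `Q` survives `insert e (F e)`,
  -- contrary to criticality.
  have hsub : M ⊆ Q ∪ Q.biUnion fun g => M.filter fun e => g ∈ F e := by
    intro e he
    by_contra hn
    simp only [Finset.mem_union, Finset.mem_biUnion, Finset.mem_filter, not_or, not_exists,
      not_and] at hn
    refine (hFc e he).2 (hQ _ fun x hx => ?_)
    rintro (rfl | hxF)
    · exact hn.1 hx
    · exact hn.2 x hx he hxF
  refine (Finset.card_le_card hsub).trans ((Finset.card_union_le _ _).trans
    (Nat.add_le_add hQD ?_))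
  refine (Finset.card_biUnion_le_card_mul _ _ (4 * D) fun g _ => ?_).trans
    (Nat.mul_le_mul_right _ hQD)
  -- Deleting `g` from the graph for good leaves the single failure `F e \ {g}`, with the same
  -- surviving walks.
  refine card_le_of_crit_one (G := deleteEdges G {g}) (s := s) (t := t) D _ fun e he => ?_
  simp only [Finset.mem_filter] at he
  have hU : {g} ∪ F e \ {g} = F e := by
    simpa using he.2
  refine ⟨F e \ {g}, ?_, ?_, ?_⟩
  · have h1 := Set.encard_sdiff_singleton_add_one he.2
    have h2 := hF2 e he.1
    rw [← h1, show (2 : ℕ∞) = 1 + 1 by norm_num] at h2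
    exact (ENat.add_le_add_iff_right (by simp)).1 h2
  · have := hFc e he.1
    simpa only [Crit, Avoid, deleteEdges_deleteEdges, Set.union_insert, hU] using this
  · have := hFD e he.1
    simpa only [between, Avoid, deleteEdges_deleteEdges, hU] using this

end Counting

/-! ### Submodular cuts and critical edges from a fixed source -/

section Cuts

variable {V : Type*} [Fintype V] {G : Digraph V} {s t v : V}

open Classical in
/-- The edges that leave the set `A`. -/
noncomputable def outCut (G : Digraph V) (A : Set V) : Finset (V × V) :=
  Finset.univ.filter fun e => G.Adj e.1 e.2 ∧ e.1 ∈ A ∧ e.2 ∉ A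

lemma mem_outCut {A : Set V} {e : V × V} :
    e ∈ outCut G A ↔ G.Adj e.1 e.2 ∧ e.1 ∈ A ∧ e.2 ∉ A := by
  simp [outCut]

open Classical in
lemma card_outCut_union_add_inter (A B : Set V) :
    (outCut G (A ∪ B)).card + (outCut G (A ∩ B)).card ≤
      (outCut G A).card + (outCut G B).card := by
  rw [← Finset.card_union_add_card_inter, ← Finset.card_union_add_card_inter (outCut G A)]
  refine Nat.add_le_add (Finset.card_le_card ?_) (Finset.card_le_card ?_) <;>
  · intro e
    simp only [Finset.mem_union, Finset.mem_inter, mem_outCut, Set.mem_union, Set.mem_inter_iff]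
    tauto

/-- `u` is reachable from the set `S` inside the set `B`. -/
def ReachIn (G : Digraph V) (B S : Set V) (u : V) : Prop :=
  ∃ s ∈ S, Relation.ReflTransGen (fun a b => G.Adj a b ∧ b ∈ B) s u

lemma ReachIn.exists_outCut {B S A : Set V} {u : V} (h : ReachIn G B S u) (hS : S ⊆ A)
    (hu : u ∉ A) : ∃ x ∈ outCut G A, x.2 ∈ B := by
  obtain ⟨s, hs, h⟩ := h
  induction h with
  | refl => exact absurd (hS hs) hu
  | @tail b c _ hbc ih =>
    by_cases hb : b ∈ A
    · exact ⟨(b, c), mem_outCut.2 ⟨hbc.1, hb, hu⟩, hbc.2⟩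
    · exact ih hb

/-- `N` bounds the number of edges into `v` that leave sets separating `v` from `S` with at most
three leaving edges, if all the sets separating `v` from `S` have at least `c` leaving edges. -/
def CutDegreeBound (G : Digraph V) (v : V) (c N : ℕ) : Prop :=
  ∀ (S : Set V) (M : Finset (V × V)) (B : V × V → Set V),
    (∀ A, S ⊆ A → v ∉ A → c ≤ (outCut G A).card) →
    (∀ e ∈ M, G.Adj e.1 e.2 ∧ e.2 = v ∧ S ⊆ B e ∧ v ∉ B e ∧ (outCut G (B e)).card ≤ 3 ∧
      e.1 ∈ B e ∧ ReachIn G (B e) S e.1) → M.card ≤ N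

open Classical in
-- When no cut has fewer than three edges, submodularity keeps unions of cuts of size at most three
-- at size at most three. The union of all `B e` is then one cut containing all of `M`.
lemma cutDegreeBound_three : CutDegreeBound G v 3 3 := by
  intro S M B hc hB
  have key : ∀ M' ⊆ M, M'.Nonempty → ∃ A, S ⊆ A ∧ v ∉ A ∧ (outCut G A).card ≤ 3 ∧
      ∀ e ∈ M', e.1 ∈ A := by
    intro M'
    induction M' using Finset.induction_on with
    | empty => intro _ h; simp at h
    | insert e M' _ ih =>
      intro hsub _
      obtain ⟨-, -, h1, h2, h3, h4, -⟩ := hB e (hsub (Finset.mem_insert_self _ _))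
      rcases M'.eq_empty_or_nonempty with rfl | hne
      · exact ⟨B e, h1, h2, h3, by simpa using h4⟩
      · obtain ⟨A, a1, a2, a3, a4⟩ := ih ((Finset.subset_insert _ _).trans hsub) hne
        refine ⟨A ∪ B e, a1.trans Set.subset_union_left, by simp [a2, h2], ?_, ?_⟩
        · have := card_outCut_union_add_inter (G := G) A (B e)
          have := hc (A ∩ B e) (Set.subset_inter a1 h1) (by simp [a2])
          omega
        · intro x hx
          rcases Finset.mem_insert.1 hx with rfl | hx
          · exact .inr h4
          · exact .inl (a4 x hx)
  rcases M.eq_empty_or_nonempty with rfl | hne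
  · simp
  obtain ⟨A, -, a2, a3, a4⟩ := key M subset_rfl hne
  refine (Finset.card_le_card fun e he => ?_).trans a3
  obtain ⟨h1, h2, -⟩ := hB e he
  exact mem_outCut.2 ⟨h1, a4 e he, h2 ▸ a2⟩

open Classical in
-- Take an inclusion-maximal cut `A` with exactly `c` edges. An edge of `M` with tail in `A` is one
-- of these `c`. For any other `e`, the walk to its tail inside `B e` leaves `A` by one of the `c`
-- edges `x`. Enlarging the source set to `A` and the head of `x` forces all cuts to have more than
-- `c` edges, by maximality, and submodularity keeps `B e ∪ A` at size at most three.
lemma CutDegreeBound.step {c N : ℕ} (h : CutDegreeBound G v (c + 1) N) (hc0 : 1 ≤ c) :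
    CutDegreeBound G v c (c + c * N) := by
  intro S M B hc hB
  by_cases hex : ∃ A, S ⊆ A ∧ v ∉ A ∧ (outCut G A).card = c
  swap
  · push Not at hex
    have := h S M B (fun A h1 h2 => lt_of_le_of_ne (hc A h1 h2) (hex A h1 h2).symm) hB
    nlinarith
  obtain ⟨A, hA⟩ := (Set.toFinite {A | S ⊆ A ∧ v ∉ A ∧ (outCut G A).card = c}).exists_maximal hex
  obtain ⟨hSA, hvA, hcA⟩ := hA.prop
  have hsub : M ⊆ outCut G A ∪
      (outCut G A).biUnion fun x => M.filter fun e => e.1 ∉ A ∧ x.2 ∈ B e ∪ A := by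
    intro e he
    obtain ⟨h1, h2, h3, h4, h5, h6, h7⟩ := hB e he
    by_cases heA : e.1 ∈ A
    · exact Finset.mem_union_left _ (mem_outCut.2 ⟨h1, heA, h2 ▸ hvA⟩)
    · obtain ⟨x, hx, hxB⟩ := h7.exists_outCut hSA heA
      refine Finset.mem_union_right _ (Finset.mem_biUnion.2 ⟨x, hx, ?_⟩)
      exact Finset.mem_filter.2 ⟨he, heA, .inl hxB⟩
  refine (Finset.card_le_card hsub).trans ((Finset.card_union_le _ _).trans
    (Nat.add_le_add hcA.le ?_))
  refine (Finset.card_biUnion_le_card_mul _ _ N fun x hx => ?_).trans_eq (by rw [hcA])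
  obtain ⟨-, hx1, hx2⟩ := mem_outCut.1 hx
  refine h (insert x.2 A) _ (fun e => B e ∪ A) (fun A' h1 h2 => ?_) fun e he => ?_
  · have hAA' := (Set.subset_insert _ _).trans h1
    refine lt_of_le_of_ne (hc A' (hSA.trans hAA') h2) fun heq => hx2 ?_
    exact hA.le_of_ge ⟨hSA.trans hAA', h2, heq.symm⟩ hAA' (h1 (Set.mem_insert _ _))
  · obtain ⟨heM, heA, hxB⟩ := Finset.mem_filter.1 he
    obtain ⟨h1, h2, h3, h4, h5, h6, s, hs, h7⟩ := hB e heM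
    refine ⟨h1, h2, Set.insert_subset hxB Set.subset_union_right, by simp [h4, hvA], ?_, .inl h6,
      s, .inr (hSA hs), Relation.ReflTransGen.mono (fun a b hab => ⟨hab.1, .inl hab.2⟩) _ _ h7⟩
    have := card_outCut_union_add_inter (G := G) (B e) A
    have := hc (B e ∩ A) (Set.subset_inter h3 hSA) (by simp [h4])
    omega

/-- The bounds for `c = 3, 2, 1` are `3`, `2 + 2 * 3 = 8` and `1 + 1 * 8 = 9`. -/
lemma cutDegreeBound_one : CutDegreeBound G v 1 9 :=
  ((cutDegreeBound_three (G := G) (v := v)).step (by norm_num)).step (by norm_num)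

open Classical in
-- The vertices still reachable from `s` after the failure of `insert e (F e)` form a set that only
-- these at most three edges can leave, and `e` leaves it. All cuts have size at least one because
-- `v` is reachable.
lemma card_le_of_crit_source (M : Finset (V × V)) (hv : ∀ e ∈ M, e.2 = v)
    (h : ∀ e ∈ M, ∃ F : Set (V × V), F.encard ≤ 2 ∧ Crit G e s v F) : M.card ≤ 9 := by
  choose! F hF hc using h
  rcases M.eq_empty_or_nonempty with rfl | ⟨e₀, he₀⟩
  · simp
  refine cutDegreeBound_one {s} M (fun e => {x | Avoid G (insert e (F e)) s x})
    (fun A hA hvA => ?_) fun e he => ⟨(hc e he).adj, hv e he, ?_, (hc e he).2, ?_, ?_⟩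
  · have hr : ReachIn G Set.univ {s} v := ⟨s, rfl,
      Relation.ReflTransGen.mono (fun a b hab => ⟨hab.1, trivial⟩) _ _ (hc e₀ he₀).1⟩
    obtain ⟨x, hx, -⟩ := hr.exists_outCut hA hvA
    exact Finset.card_pos.2 ⟨x, hx⟩
  · rintro _ rfl
    exact .refl
  · have h1 : ((outCut G {x | Avoid G (insert e (F e)) s x} : Finset (V × V)) : Set (V × V)) ⊆
        insert e (F e) := by
      intro x hx
      obtain ⟨h1, h2, h3⟩ := mem_outCut.1 (Finset.mem_coe.1 hx)
      by_contra hn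
      exact h3 (h2.trans (.single h1 hn))
    have h2 := (Set.encard_le_encard h1).trans ((Set.encard_insert_le _ _).trans
      (add_le_add_left (hF e he) 1))
    rw [Set.encard_coe_eq_coe_finsetCard] at h2
    exact_mod_cast h2
  · have h1 := (hc e he).through (F' := F e) (by simpa using (hc e he).1)
    have h2 : Avoid G (insert e (F e)) s e.1 := by
      simpa [Set.union_comm] using h1.2.2.1
    refine ⟨h2, s, rfl, ?_⟩
    generalize e.1 = u at h2
    induction h2 with
    | refl => exact .refl
    | tail hab hbc ih => exact ih.tail ⟨hbc.1, hab.tail hbc⟩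

/-! ### Critical edges whose witness contains a given vertex -/

/-- The graph with all the edges reversed. -/
def rev (G : Digraph V) : Digraph V := ⟨fun u v => G.Adj v u⟩

omit [Fintype V] in
lemma avoid_rev {F : Set (V × V)} : Avoid (rev G) (Prod.swap ⁻¹' F) t s ↔ Avoid G F s t :=
  Relation.reflTransGen_swap (r := (deleteEdges G F).Adj)

omit [Fintype V] in
lemma Crit.rev {F : Set (V × V)} {e : V × V} (h : Crit G e s t F) :
    Crit (rev G) e.swap t s (Prod.swap ⁻¹' F) := by
  refine ⟨avoid_rev.2 h.1, fun h' => h.2 (avoid_rev.1 ?_)⟩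
  convert h' using 2
  ext x
  simp [Prod.ext_iff, and_comm]

omit [Fintype V] in
lemma Crit.from_tail {F : Set (V × V)} {e : V × V} (h : Crit G e s t F) :
    Crit G e e.1 t F := by
  have h1 := h.through (F' := F) (by simpa using h.1)
  simp only [Set.union_self] at h1
  refine ⟨(Avoid.single h1.2.1 h1.1).trans h1.2.2.2, fun h2 => h.2 ?_⟩
  exact (h1.2.2.1.anti (by simp)).trans h2

open Classical in
/-- At most `18 n` edges are critical for failures that leave the vertex `r` between the two
terminals. -/
lemma card_crit_through_le (r : V) (M : Finset (V × V))
    (h : ∀ e ∈ M, ∃ (s t : V) (F : Set (V × V)), F.encard ≤ 2 ∧ Crit G e s t F ∧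
      r ∈ between G s t F) : M.card ≤ 18 * Fintype.card V := by
  let M₁ := M.filter fun e => ∃ (t : V) (F : Set (V × V)), F.encard ≤ 2 ∧ Crit G e r t F
  let M₂ := M.filter fun e => ∃ (s : V) (F : Set (V × V)), F.encard ≤ 2 ∧ Crit G e s r F
  have hsub : M ⊆ M₁ ∪ M₂ := by
    intro e he
    obtain ⟨s, t, F, hF, hc, h1, h2⟩ := h e he
    -- Since `e` is unavoidable from `s` to `t`, it is unavoidable on at least one of the two legs
    -- via `r`. The leg into `r` is handled by reversing all edges, and each leg contributes `9 n`.
    by_cases h3 : Avoid G (insert e F) s r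
    · refine Finset.mem_union_left _ (Finset.mem_filter.2 ⟨he, t, F, hF, h2, fun h4 => ?_⟩)
      exact hc.2 (h3.trans h4)
    · exact Finset.mem_union_right _ (Finset.mem_filter.2 ⟨he, s, F, hF, h1, h3⟩)
  have c₁ : M₁.card ≤ 9 * (Finset.univ : Finset V).card := by
    refine Finset.card_le_mul_card_image_of_maps_to (f := Prod.snd) (by simp) 9 fun v _ => ?_
    refine card_le_of_crit_source (G := G) (s := r) (v := v) _ (by simp) fun e he => ?_
    obtain ⟨he₁, rfl⟩ := Finset.mem_filter.1 he
    obtain ⟨-, t, F, hF, hc⟩ := Finset.mem_filter.1 he₁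
    exact ⟨F, hF, hc.to_head⟩
  have c₂ : M₂.card ≤ 9 * (Finset.univ : Finset V).card := by
    refine Finset.card_le_mul_card_image_of_maps_to (f := Prod.fst) (by simp) 9 fun v _ => ?_
    rw [← Finset.card_map (Equiv.prodComm V V).toEmbedding]
    refine card_le_of_crit_source (G := rev G) (s := r) (v := v) _ (by simp) fun e he => ?_
    obtain ⟨e, he₁, rfl⟩ := Finset.mem_map.1 he
    obtain ⟨he₂, rfl⟩ := Finset.mem_filter.1 he₁
    obtain ⟨-, s, F, hF, hc⟩ := Finset.mem_filter.1 he₂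
    refine ⟨Prod.swap ⁻¹' F, ?_, hc.from_tail.rev⟩
    rw [← Set.image_swap_eq_preimage_swap, Prod.swap_injective.encard_image]
    exact hF
  have := (Finset.card_le_card hsub).trans (Finset.card_union_le _ _)
  rw [Finset.card_univ] at c₁ c₂
  omega

/-! ### The edge bound: balancing small and large witnesses -/

open Classical in
lemma card_le_of_crit_pairs (P : Finset (V × V)) (M : Finset (V × V)) {D : ℕ} (hD : 1 ≤ D)
    (h : ∀ e ∈ M, ∃ p ∈ P, ∃ F : Set (V × V), F.encard ≤ 2 ∧ Crit G e p.1 p.2 F) :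
    D * M.card ≤ 5 * D ^ 3 * P.card + 18 * Fintype.card V ^ 2 := by
  choose! p hp F hF hc using h
  let w : V × V → Set V := fun e => between G (p e).1 (p e).2 (F e)
  let M₁ := M.filter fun e => (w e).ncard ≤ D
  let M₂ := M.filter fun e => ¬ (w e).ncard ≤ D
  have hM : M₁.card + M₂.card = M.card := Finset.card_filter_add_card_filter_not _
  have c₁ : M₁.card ≤ (D + D * (4 * D)) * P.card := by
    refine Finset.card_le_mul_card_image_of_maps_to (f := p)
      (fun e he => hp e (Finset.mem_filter.1 he).1) _ fun q _ => ?_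
    refine card_le_of_crit_two (G := G) (s := q.1) (t := q.2) D _ fun e he => ?_
    obtain ⟨he₁, rfl⟩ := Finset.mem_filter.1 he
    obtain ⟨he₂, hw⟩ := Finset.mem_filter.1 he₁
    exact ⟨F e, hF e he₂, hc e he₂, hw⟩
  -- Double counting of the incidences between edges of `M₂` and the vertices `r` of their
  -- witnesses: each edge has more than `D`, each vertex at most `18 n`.
  have c₂ : M₂.card * D ≤ 18 * Fintype.card V ^ 2 := by
    calc M₂.card * D ≤ ∑ e ∈ M₂, (w e).ncard :=
          Finset.card_nsmul_le_sum _ _ _ fun e he => (not_le.1 (Finset.mem_filter.1 he).2).le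
      _ = ∑ e ∈ M₂, ∑ r : V, if r ∈ w e then 1 else 0 := by
          refine Finset.sum_congr rfl fun e _ => ?_
          rw [Finset.sum_boole, Set.ncard_eq_toFinset_card', Set.filter_mem_univ_eq_toFinset]
          simp
      _ = ∑ r : V, (M₂.filter fun e => r ∈ w e).card := by
          rw [Finset.sum_comm]
          simp [Finset.sum_boole]
      _ ≤ ∑ r : V, 18 * Fintype.card V := by
          refine Finset.sum_le_sum fun r _ => card_crit_through_le (G := G) r _ fun e he => ?_
          obtain ⟨he, hr⟩ := Finset.mem_filter.1 he
          have he := (Finset.mem_filter.1 he).1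
          exact ⟨_, _, F e, hF e he, hc e he, hr⟩
      _ = 18 * Fintype.card V ^ 2 := by simp; ring
  have c₃ : D + D * (4 * D) ≤ 5 * D ^ 2 := by nlinarith
  calc D * M.card = D * M₁.card + M₂.card * D := by rw [← hM]; ring
    _ ≤ D * (5 * D ^ 2 * P.card) + 18 * Fintype.card V ^ 2 := by
        gcongr
        exact c₁.trans (Nat.mul_le_mul_right _ c₃)
    _ = _ := by ring

/-- The edge `e` is critical for a pair in `P` and at most two failing edges. -/
def CritFor (H : Digraph V) (P : Set (V × V)) (e : V × V) : Prop :=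
  ∃ p ∈ P, ∃ F : Set (V × V), F.encard ≤ 2 ∧ Crit H e p.1 p.2 F

/-- Every edge of `H` is critical for a pair in `P` and at most two failing edges. -/
def IsCritical (H : Digraph V) (P : Set (V × V)) : Prop :=
  ∀ e ∈ edges H, CritFor H P e

/-- The edge bound for graphs all of whose edges are critical. -/
lemma IsCritical.ncard_edges_le {H : Digraph V} {P : Set (V × V)} (h : IsCritical H P) :
    ((edges H).ncard : ℝ) ≤
      38 * (Fintype.card V : ℝ) ^ (4 / 3 : ℝ) * (P.ncard : ℝ) ^ (1 / 3 : ℝ) := by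
  classical
  -- An edge, being critical, guarantees `P` nonempty and `n > 0`, which the divisions below need.
  rcases (edges H).eq_empty_or_nonempty with h0 | ⟨e, he⟩
  · rw [h0]; simp; positivity
  obtain ⟨p, hp, -⟩ := h e he
  have hP : 0 < P.ncard := (Set.ncard_pos (Set.toFinite P)).2 ⟨p, hp⟩
  have hPn : P.ncard ≤ Fintype.card V ^ 2 := by
    refine (Set.ncard_le_card P).trans_eq ?_
    simp [sq]
  set n : ℝ := (Fintype.card V : ℝ) with hn
  set q : ℝ := (P.ncard : ℝ) with hq
  have hq0 : 0 < q := Nat.cast_pos.2 hP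
  have hqn : q ≤ n ^ 2 := by rw [hq, hn]; exact_mod_cast hPn
  have hn0 : 0 < n := by
    have : Nonempty V := ⟨p.1⟩
    exact Nat.cast_pos.2 Fintype.card_pos
  -- This is `(n² / |P|)^(1/3)`, where `x² |P|` and `n² / x` agree. It is at least `1` because `|P|
  -- ≤ n²`, so rounding up at most doubles it.
  set x : ℝ := n ^ (2 / 3 : ℝ) * q ^ (-(1 / 3) : ℝ) with hx
  have hx0 : 0 < x := by positivity
  have hx3 : x ^ 3 * q = n ^ 2 := by
    rw [hx, mul_pow, ← Real.rpow_natCast, ← Real.rpow_natCast, ← Real.rpow_mul hn0.le,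
      ← Real.rpow_mul hq0.le]
    norm_num
    rw [Real.rpow_neg_one]
    field_simp
  have hx1 : 1 ≤ x := by
    by_contra! hlt
    have : x ^ 3 < 1 := pow_lt_one₀ hx0.le hlt (by norm_num)
    nlinarith
  have hbound : n ^ (4 / 3 : ℝ) * q ^ (1 / 3 : ℝ) * x = n ^ 2 := by
    rw [hx, mul_mul_mul_comm, ← Real.rpow_add hn0, ← Real.rpow_add hq0]
    norm_num
  set D : ℕ := ⌈x⌉₊ with hD
  have hD1 : x ≤ D := Nat.le_ceil x
  have hD2 : (D : ℝ) ≤ 2 * x := by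
    have := Nat.ceil_lt_add_one hx0.le
    linarith
  have hD0 : 1 ≤ D := Nat.one_le_ceil_iff.2 hx0
  have key := card_le_of_crit_pairs (G := H) P.toFinset (edges H).toFinset hD0
    (by simpa [IsCritical, CritFor] using h)
  rw [← Set.ncard_eq_toFinset_card', ← Set.ncard_eq_toFinset_card'] at key
  have key' : (D : ℝ) * (edges H).ncard ≤ 5 * (D : ℝ) ^ 3 * q + 18 * n ^ 2 := by
    rw [hq, hn]; exact_mod_cast key
  set m : ℝ := ((edges H).ncard : ℝ)
  rw [mul_assoc]
  set B : ℝ := n ^ (4 / 3 : ℝ) * q ^ (1 / 3 : ℝ)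
  have hB : x ^ 2 * q = B := by
    refine mul_right_cancel₀ hx0.ne' ?_
    linarith [show x ^ 2 * q * x = x ^ 3 * q by ring]
  have hB0 : 0 ≤ B := by positivity
  have hDpos : (0 : ℝ) < D := by exact_mod_cast hD0
  have h1 : 5 * (D : ℝ) ^ 3 * q ≤ D * (20 * B) := by
    have : (D : ℝ) ^ 2 ≤ (2 * x) ^ 2 := pow_le_pow_left₀ hDpos.le hD2 2
    calc 5 * (D : ℝ) ^ 3 * q = 5 * D * q * (D : ℝ) ^ 2 := by ring
      _ ≤ 5 * D * q * (2 * x) ^ 2 := by gcongr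
      _ = D * (20 * (x ^ 2 * q)) := by ring
      _ = _ := by rw [hB]
  have h2 : n ^ 2 ≤ D * B := by
    rw [← hbound, mul_comm]
    gcongr
  -- The constant is `5 * 2² + 18 = 38`.
  refine le_of_mul_le_mul_left ?_ hDpos
  linarith

end Cuts

/-! ### Greedy deletion of edges that are not critical -/

section Greedy

variable {V : Type*} {G H : Digraph V} {P : Set (V × V)} {e e' : V × V}

lemma isFTRS_refl : IsFTRS 2 G P G := ⟨le_refl G, fun _ _ _ _ _ _ => Iff.rfl⟩

lemma avoid_deleteEdges {F F' : Set (V × V)} {s t : V} :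
    Avoid (deleteEdges H F) F' s t ↔ Avoid H (F ∪ F') s t := by
  rw [Avoid, deleteEdges_deleteEdges]

lemma IsFTRS.deleteEdges (h : IsFTRS 2 G P H) (he : ¬ CritFor H P e) :
    IsFTRS 2 G P (deleteEdges H {e}) := by
  refine ⟨fun u v huv => h.1 huv.1, fun s t hst F hF hF2 => ?_⟩
  rw [h.2 s t hst F hF hF2]
  refine ⟨fun h1 => ?_, fun h1 => Reachable.mono h1 fun u v huv => ⟨huv.1.1, huv.2⟩⟩
  by_contra hn
  refine he ⟨(s, t), hst, F, hF2, h1, fun h2 => hn (avoid_deleteEdges.2 ?_)⟩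
  rwa [Set.singleton_union]

/-- The witness of `e` still works: if deleting `e'` disconnected the pair after `F`, then `e'`
would be critical. So no edge needs a second examination by the algorithm. -/
lemma CritFor.deleteEdges (h : CritFor H P e) (he : ¬ CritFor H P e') :
    CritFor (deleteEdges H {e'}) P e := by
  obtain ⟨p, hp, F, hF, h1, h2⟩ := h
  refine ⟨p, hp, F, hF, ?_, fun h3 => h2 (Reachable.mono h3 fun u v huv => ⟨huv.1.1, huv.2⟩)⟩
  by_contra hn
  refine he ⟨p, hp, F, hF, h1, fun h3 => hn (avoid_deleteEdges.2 ?_)⟩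
  rwa [Set.singleton_union]

/-- An FTRS with the fewest edges has no edge left to delete. -/
lemma exists_isFTRS_isCritical [Finite V] (G : Digraph V) (P : Set (V × V)) :
    ∃ H, IsFTRS 2 G P H ∧ IsCritical H P := by
  obtain ⟨H, hH, hmin⟩ := (measure fun H : Digraph V => (edges H).ncard).wf.has_min
    {H | IsFTRS 2 G P H} ⟨G, isFTRS_refl⟩
  refine ⟨H, hH, fun e he => ?_⟩
  by_contra hn
  refine hmin _ (hH.deleteEdges hn) (Set.ncard_lt_ncard ⟨fun x hx => hx.1, fun hsub => ?_⟩
    (Set.toFinite _))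
  exact (hsub he).2 rfl

end Greedy

end FaultTolerant

namespace RAM

/-! ### Rules for proving that programs halt in a given time -/

/-- The program `p`, started in `σ`, halts after at most `T` steps in a state that satisfies `Q`. -/
def Ends (p : Prog) (σ : State) (T : ℕ) (Q : State → Prop) : Prop :=
  ∃ (t : ℕ) (τ : State), Exec p σ t τ ∧ t ≤ T ∧ Q τ

lemma Ends.mono {p : Prog} {σ : State} {T T' : ℕ} {Q Q' : State → Prop} (h : Ends p σ T Q)
    (hT : T ≤ T') (hQ : ∀ τ, Q τ → Q' τ) : Ends p σ T' Q' := by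
  obtain ⟨t, τ, h1, h2, h3⟩ := h
  exact ⟨t, τ, h1, h2.trans hT, hQ τ h3⟩

lemma Ends.seq {p q : Prog} {σ : State} {S T : ℕ} {Q : State → Prop}
    (h : Ends p σ S fun τ => Ends q τ T Q) : Ends (.seq p q) σ (S + T) Q := by
  obtain ⟨t, τ, h1, h2, t', ρ, h3, h4, h5⟩ := h
  exact ⟨t + t', ρ, .seq h1 h3, Nat.add_le_add h2 h4, h5⟩

lemma Ends.ite {x : ℕ} {p q : Prog} {σ : State} {T : ℕ} {Q : State → Prop}
    (hp : σ.reg x ≠ 0 → Ends p σ T Q) (hq : σ.reg x = 0 → Ends q σ T Q) :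
    Ends (.ite x p q) σ (1 + T) Q := by
  by_cases hx : σ.reg x = 0
  · obtain ⟨t, τ, h1, h2, h3⟩ := hq hx
    exact ⟨1 + t, τ, .ite_false hx h1, Nat.add_le_add_left h2 1, h3⟩
  · obtain ⟨t, τ, h1, h2, h3⟩ := hp hx
    exact ⟨1 + t, τ, .ite_true hx h1, Nat.add_le_add_left h2 1, h3⟩

/-- A loop that counts down in the register `i`. -/
lemma Ends.loop {i : ℕ} {p : Prog} {B K : ℕ} (Inv : ℕ → State → Prop)
    (hi : ∀ j σ, Inv j σ → σ.reg i = j)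
    (hstep : ∀ j < K, ∀ σ, Inv (j + 1) σ → Ends p σ B (Inv j)) {σ : State} (h : Inv K σ) :
    -- Each iteration pays one step for its test, and the last, failing test pays one more.
    Ends (.loop i p) σ (K * (B + 1) + 1) (Inv 0) := by
  induction K generalizing σ with
  | zero => exact ⟨1, σ, .loop_false (hi _ _ h), by simp, h⟩
  | succ K ih =>
    obtain ⟨t, τ, h1, h2, h3⟩ := hstep K (Nat.lt_succ_self K) σ h
    obtain ⟨t', ρ, h4, h5, h6⟩ := ih (fun j hj => hstep j (hj.trans (Nat.lt_succ_self K))) h3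
    refine ⟨1 + t + t', ρ, .loop_true (by rw [hi _ _ h]; omega) h1 h4, ?_, h6⟩
    rw [Nat.succ_mul]
    omega

/-- The program writes only to registers from `L` on. -/
def Prog.above (L : ℕ) : Prog → Bool
  | .const x _ => L ≤ x
  | .copy x _ => L ≤ x
  | .add x _ _ => L ≤ x
  | .sub x _ _ => L ≤ x
  | .load x _ => L ≤ x
  | .store _ _ => true
  | .seq p q => p.above L && q.above L
  | .ite _ p q => p.above L && q.above L
  | .loop _ p => p.above L

lemma reg_eq_of_above {L : ℕ} {p : Prog} {σ τ : State} {t : ℕ} (h : Exec p σ t τ)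
    (hp : p.above L = true) {x : ℕ} (hx : x < L) : τ.reg x = σ.reg x := by
  induction h with
  | store => rfl
  | seq _ _ ih ih' =>
    simp only [Prog.above, Bool.and_eq_true] at hp
    rw [ih' hp.2, ih hp.1]
  | ite_true _ _ ih =>
    simp only [Prog.above, Bool.and_eq_true] at hp
    exact ih hp.1
  | ite_false _ _ ih =>
    simp only [Prog.above, Bool.and_eq_true] at hp
    exact ih hp.2
  | loop_true _ _ _ ih ih' =>
    rw [ih' hp, ih hp]
  | loop_false => rfl
  | _ =>
    simp only [Prog.above, decide_eq_true_eq] at hp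
    exact Function.update_of_ne (by omega) _ _

/-- A frame rule: the preservation of low registers is read off the program text, by `rfl`. -/
lemma Ends.above {p : Prog} {σ : State} {T : ℕ} {Q : State → Prop} (h : Ends p σ T Q) (L : ℕ)
    (hp : p.above L = true) : Ends p σ T fun τ => (∀ x < L, τ.reg x = σ.reg x) ∧ Q τ := by
  obtain ⟨t, τ, h1, h2, h3⟩ := h
  exact ⟨t, τ, h1, h2, fun x hx => reg_eq_of_above h1 hp hx, h3⟩

/-- Programs without loops. -/
def Prog.loopFree : Prog → Bool
  | .seq p q => p.loopFree && q.loopFree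
  | .ite _ p q => p.loopFree && q.loopFree
  | .loop _ _ => false
  | _ => true

/-- A bound on the number of steps of a program without loops. -/
def Prog.cost : Prog → ℕ
  | .seq p q => p.cost + q.cost
  | .ite _ p q => 1 + (p.cost + q.cost)
  | _ => 1

/-- The final state of a program without loops. -/
def Prog.eval : Prog → State → State
  | .const x c, σ => σ.setReg x c
  | .copy x y, σ => σ.setReg x (σ.reg y)
  | .add x y z, σ => σ.setReg x (σ.reg y + σ.reg z)
  | .sub x y z, σ => σ.setReg x (σ.reg y - σ.reg z)
  | .load x y, σ => σ.setReg x (σ.mem (σ.reg y))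
  | .store x y, σ => σ.setMem (σ.reg x) (σ.reg y)
  | .seq p q, σ => q.eval (p.eval σ)
  | .ite x p q, σ => if σ.reg x = 0 then q.eval σ else p.eval σ
  | .loop _ _, σ => σ

/-- Code without loops is verified by computing `Prog.eval` with `simp`. -/
lemma Ends.block {p : Prog} (hp : p.loopFree = true) {σ : State} {Q : State → Prop}
    (h : Q (p.eval σ)) : Ends p σ p.cost Q := by
  induction p generalizing σ Q with
  | const => exact ⟨1, _, .const .., le_rfl, h⟩
  | copy => exact ⟨1, _, .copy .., le_rfl, h⟩
  | add => exact ⟨1, _, .add .., le_rfl, h⟩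
  | sub => exact ⟨1, _, .sub .., le_rfl, h⟩
  | load => exact ⟨1, _, .load .., le_rfl, h⟩
  | store => exact ⟨1, _, .store .., le_rfl, h⟩
  | seq p q ihp ihq =>
    simp only [Prog.loopFree, Bool.and_eq_true] at hp
    exact .seq (ihp hp.1 (ihq hp.2 h))
  | ite x p q ihp ihq =>
    simp only [Prog.loopFree, Bool.and_eq_true] at hp
    refine .ite (fun hx => (ihp hp.1 ?_).mono (Nat.le_add_right _ _) fun _ => id)
      fun hx => (ihq hp.2 ?_).mono (Nat.le_add_left _ _) fun _ => id
    · simpa [Prog.eval, hx] using h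
    · simpa [Prog.eval, hx] using h
  | loop => simp [Prog.loopFree] at hp

lemma Ends.block_seq {p q : Prog} (hp : p.loopFree = true) {σ : State} {T : ℕ}
    {Q : State → Prop} (h : Ends q (p.eval σ) T Q) : Ends (.seq p q) σ (p.cost + T) Q :=
  .seq (.block hp h)

end RAM

namespace FaultTolerant

open RAM

local infixr:60 " ;; " => Prog.seq

/-! ### The program: reachability -/

/-- The registers `1`, …, `7` hold constants, the memory below `4 n² + 1` holds the graph `a`, the
pairs `p`, and the tables of the end points of the pairs of vertices. -/
structure Env (n : ℕ) (a p : ℕ → ℕ) (σ : State) : Prop where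
  r1 : σ.reg 1 = 1
  r2 : σ.reg 2 = n
  r3 : σ.reg 3 = n * n
  r4 : σ.reg 4 = n * n + 1
  r5 : σ.reg 5 = 2 * (n * n) + 1
  r6 : σ.reg 6 = 3 * (n * n) + 1
  r7 : σ.reg 7 = 4 * (n * n) + 1
  graph : ∀ k < n * n, σ.mem (k + 1) = a k
  pairs : ∀ k < n * n, σ.mem (n * n + 1 + k) = p k
  tail : ∀ k < n * n, σ.mem (2 * (n * n) + 1 + k) = k / n
  head : ∀ k < n * n, σ.mem (3 * (n * n) + 1 + k) = k % n

/-- The registers below `L` and the memory below `4 n² + 1` are the same in both states. -/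
structure Same (n L : ℕ) (σ τ : State) : Prop where
  reg : ∀ x < L, τ.reg x = σ.reg x
  mem : ∀ x < 4 * (n * n) + 1, τ.mem x = σ.mem x

variable {n L L' : ℕ} {a p : ℕ → ℕ} {σ τ ρ : State}

lemma Same.trans (h : Same n L σ τ) (h' : Same n L τ ρ) : Same n L σ ρ :=
  ⟨fun x hx => (h'.reg x hx).trans (h.reg x hx), fun x hx => (h'.mem x hx).trans (h.mem x hx)⟩

lemma Same.le (h : Same n L σ τ) (hL : L' ≤ L) : Same n L' σ τ :=
  ⟨fun x hx => h.reg x (hx.trans_le hL), h.mem⟩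

lemma Env.same (h : Env n a p σ) (hs : Same n L σ τ) (hL : 8 ≤ L) : Env n a p τ where
  r1 := (hs.reg _ (by omega)).trans h.r1
  r2 := (hs.reg _ (by omega)).trans h.r2
  r3 := (hs.reg _ (by omega)).trans h.r3
  r4 := (hs.reg _ (by omega)).trans h.r4
  r5 := (hs.reg _ (by omega)).trans h.r5
  r6 := (hs.reg _ (by omega)).trans h.r6
  r7 := (hs.reg _ (by omega)).trans h.r7
  graph k hk := (hs.mem _ (by omega)).trans (h.graph k hk)
  pairs k hk := (hs.mem _ (by omega)).trans (h.pairs k hk)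
  tail k hk := (hs.mem _ (by omega)).trans (h.tail k hk)
  head k hk := (hs.mem _ (by omega)).trans (h.head k hk)

/-- The step relation of the graph `a` without the slots `f₁, f₂, f₃`. -/
def StepRel (n : ℕ) (a : ℕ → ℕ) (f₁ f₂ f₃ : ℕ) (x y : ℕ) : Prop :=
  ∃ k < n * n, (a k ≠ 0 ∧ k ≠ f₁ ∧ k ≠ f₂ ∧ k ≠ f₃) ∧ k / n = x ∧ k % n = y

/-- Does nothing of interest. -/
def nop : Prog := .const 20 0

/-- Continues with `q` unless the registers `x` and `y` are equal. -/
def unlessEq (x y : ℕ) (q : Prog) : Prog :=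
  -- With truncated subtraction, the sum of both differences vanishes exactly when the registers
  -- agree.
  .sub 21 x y ;; .sub 22 y x ;; .add 21 21 22 ;; .ite 21 q nop

/-- Marks the head of the slot in register `19` if its tail is marked and it is an edge other than
those in the registers `9`, `10`, `13`. -/
def relax : Prog :=
  .add 20 19 1 ;; .load 20 20 ;; .ite 20
    (unlessEq 19 9 (unlessEq 19 10 (unlessEq 19 13
      (.add 20 5 19 ;; .load 20 20 ;; .add 20 7 20 ;; .load 20 20 ;; .ite 20
        (.add 20 6 19 ;; .load 20 20 ;; .add 20 7 20 ;; .store 20 1) nop)))) nop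

/-- Removes all the marks. -/
def clear : Prog :=
  .copy 18 2 ;; .loop 18 (.sub 18 18 1 ;; .add 20 7 18 ;; .store 20 21)

/-- Marks the heads of the edges with marked tails. -/
def relaxAll : Prog := .copy 19 3 ;; .loop 19 (.sub 19 19 1 ;; relax)

/-- Marks the vertices reachable from the marked vertex. -/
def rounds : Prog := .copy 18 2 ;; .loop 18 (.sub 18 18 1 ;; relaxAll)

/-- Marks the vertices reachable from the vertex in register `14`. -/
def reach : Prog :=
  .const 21 0 ;; clear ;; (.add 20 7 14 ;; .store 20 1) ;; rounds

lemma Env.relax_mem (h : Env n a p σ) (hk : σ.reg 19 < n * n) :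
    (relax.eval σ).mem =
      if (a (σ.reg 19) ≠ 0 ∧ σ.reg 19 ≠ σ.reg 9 ∧ σ.reg 19 ≠ σ.reg 10 ∧ σ.reg 19 ≠ σ.reg 13) ∧
        σ.mem (4 * (n * n) + 1 + σ.reg 19 / n) ≠ 0 then
      Function.update σ.mem (4 * (n * n) + 1 + σ.reg 19 % n) 1 else σ.mem := by
  simp [relax, unlessEq, nop, Prog.eval, State.setReg, State.setMem,
    h.r1, h.r5, h.r6, h.r7, h.graph _ hk, h.tail _ hk, h.head _ hk, apply_ite State.mem]
  split_ifs <;> first | rfl | omega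

lemma Env.clear_spec (h : Env n a p σ) (h21 : σ.reg 21 = 0) :
    Ends clear σ (4 * n + 2)
      fun τ => Same n 18 σ τ ∧ ∀ v < n, τ.mem (4 * (n * n) + 1 + v) = 0 := by
  let Inv : ℕ → State → Prop := fun j τ => τ.reg 18 = j ∧ τ.reg 21 = 0 ∧ Same n 18 σ τ ∧
    ∀ v < n, j ≤ v → τ.mem (4 * (n * n) + 1 + v) = 0
  refine (Ends.block_seq rfl (Ends.loop (B := 3) Inv (fun j σ h => h.1) (K := n) ?_ ?_)).mono
    (by simp only [Prog.cost]; omega) (fun τ hτ => ⟨hτ.2.2.1, fun v hv => hτ.2.2.2 v hv (by omega)⟩)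
  · rintro j hj τ ⟨h1, h2, h3, h4⟩
    have he := h.same h3 (by omega)
    refine Ends.mono (Ends.block rfl ?_) (by simp [Prog.cost]) fun _ => id
    simp only [Prog.eval, State.setReg, State.setMem, Function.update_apply, he.r1, he.r7, h1, h2,
      if_true, Nat.reduceEqDiff, if_false, Nat.add_sub_cancel]
    refine ⟨by simp, by simp [h2], ⟨fun x hx => ?_, fun x hx => ?_⟩, fun v hv hjv => ?_⟩
    · simp [show x ≠ 20 by omega, show x ≠ 18 by omega, h3.reg x hx]
    · simp [show x ≠ 4 * (n * n) + 1 + j by omega, h3.mem x hx]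
    · simp only [Function.update_apply]
      split_ifs
      · rfl
      · exact h4 v hv (by omega)
  · simp only [Prog.eval, State.setReg]
    refine ⟨by simp [h.r2], by simp [h21], ⟨fun x hx => ?_, fun x hx => rfl⟩, by omega⟩
    simp [show x ≠ 18 by omega]

/-- The marked vertices. -/
def marked (n : ℕ) (σ : State) : Finset ℕ :=
  (Finset.range n).filter fun v => σ.mem (4 * (n * n) + 1 + v) ≠ 0

lemma mem_marked {v : ℕ} : v ∈ marked n σ ↔ v < n ∧ σ.mem (4 * (n * n) + 1 + v) ≠ 0 := by
  simp [marked]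

/-- Marks set during the pass may already propagate in the same pass, so the new set is only bounded
from both sides. -/
lemma Env.round_spec (h : Env n a p σ) {s : ℕ}
    (hσ : ∀ v ∈ marked n σ,
      Relation.ReflTransGen (StepRel n a (σ.reg 9) (σ.reg 10) (σ.reg 13)) s v) :
    Ends relaxAll σ (40 * (n * n) + 2) fun τ =>
      Same n 19 σ τ ∧ marked n σ ⊆ marked n τ ∧
      (∀ v ∈ marked n τ,
        Relation.ReflTransGen (StepRel n a (σ.reg 9) (σ.reg 10) (σ.reg 13)) s v) ∧
      ∀ u ∈ marked n σ, ∀ v, StepRel n a (σ.reg 9) (σ.reg 10) (σ.reg 13) u v →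
        v ∈ marked n τ := by
  let Inv : ℕ → State → Prop := fun j τ => τ.reg 19 = j ∧ Same n 19 σ τ ∧
    marked n σ ⊆ marked n τ ∧ (∀ v ∈ marked n τ,
        Relation.ReflTransGen (StepRel n a (σ.reg 9) (σ.reg 10) (σ.reg 13)) s v) ∧
    ∀ k < n * n, j ≤ k → (a k ≠ 0 ∧ k ≠ σ.reg 9 ∧ k ≠ σ.reg 10 ∧ k ≠ σ.reg 13) →
      k / n ∈ marked n σ → k % n ∈ marked n τ
  refine (Ends.block_seq rfl (Ends.loop (B := 39) Inv (fun j σ h => h.1) (K := n * n) ?_ ?_)).mono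
    (by simp only [Prog.cost]; omega)
    (fun τ ⟨_, h2, h3, h4, h5⟩ => ⟨h2, h3, h4, ?_⟩)
  · rintro j hj τ ⟨h1, h2, h3, h4, h5⟩
    have hn : 0 < n := Nat.pos_of_mul_pos_left (by omega : 0 < n * n)
    set τ' := (Prog.sub 19 19 1).eval τ with hτ'
    have hm' : τ'.mem = τ.mem := rfl
    have hr' : τ'.reg 19 = j := by
      have := h2.reg 1 (by norm_num)
      simp [hτ', Prog.eval, State.setReg, h1, this, h.r1]
    have hs' : Same n 19 τ τ' := ⟨fun x hx => by
      simp [hτ', Prog.eval, State.setReg, show x ≠ 19 by omega], fun _ _ => rfl⟩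
    have hs := h2.trans hs'
    have he := h.same hs (by omega)
    have hmem := he.relax_mem (by omega)
    rw [hr', hs.reg 9 (by omega), hs.reg 10 (by omega), hs.reg 13 (by omega), hm'] at hmem
    refine Ends.mono (((Ends.block (Q := fun τ => τ = relax.eval τ') rfl rfl).above 20 rfl)
      |> Ends.block_seq (p := .sub 19 19 1) rfl) (by decide) ?_
    rintro ρ ⟨hreg, rfl⟩
    replace hreg : ∀ x < 20, (relax.eval τ').reg x = τ'.reg x := hreg
    show Inv j (relax.eval τ')
    have hmark : ∀ v, v ∈ marked n (relax.eval τ') ↔ v ∈ marked n τ ∨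
        ((a j ≠ 0 ∧ j ≠ σ.reg 9 ∧ j ≠ σ.reg 10 ∧ j ≠ σ.reg 13) ∧ j / n ∈ marked n τ ∧
          v = j % n) := by
      intro v
      have hdiv : j / n < n := Nat.div_lt_of_lt_mul hj
      have hmod : j % n < n := Nat.mod_lt _ hn
      simp only [mem_marked, hmem]
      split_ifs with hc
      · simp only [Function.update_apply, hdiv, true_and, hc, ne_eq, not_false_eq_true]
        by_cases hv : v = j % n
        · simp [hv, hmod]
        · simp [hv]
      · refine ⟨.inl, ?_⟩
        rintro (hv | ⟨h1, h2, -⟩)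
        · exact hv
        · exact absurd ⟨h1, h2.2⟩ hc
    refine ⟨by rw [hreg 19 (by omega), hr'], hs.trans ⟨fun x hx => hreg x (by omega),
      fun x hx => ?_⟩, fun v hv => (hmark v).2 (.inl (h3 hv)), fun v hv => ?_,
      fun k hk hjk hok hu => (hmark _).2 ?_⟩
    · rw [hmem, hm']
      split_ifs
      · exact Function.update_of_ne (by omega) _ _
      · rfl
    · rcases (hmark v).1 hv with hv | ⟨hok, hu, rfl⟩
      · exact h4 v hv
      · exact (h4 _ hu).tail ⟨j, hj, hok, rfl, rfl⟩
    · rcases eq_or_lt_of_le hjk with rfl | hjk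
      · exact .inr ⟨hok, h3 hu, rfl⟩
      · exact .inl (h5 k hk hjk hok hu)
  · simp only [Prog.eval, State.setReg]
    refine ⟨by simp [h.r3], ⟨fun x hx => ?_, fun x hx => rfl⟩, fun v hv => hv, hσ, by omega⟩
    simp [show x ≠ 19 by omega]
  · rintro u hu v ⟨k, hk, hok, rfl, rfl⟩
    exact h5 k hk (Nat.zero_le _) hok hu

lemma Env.rounds_spec (h : Env n a p σ) {s : ℕ} (hs : s < n) (hσ : marked n σ = {s}) :
    Ends rounds σ (n * (40 * (n * n) + 4) + 2) fun τ =>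
      Same n 18 σ τ ∧ ∀ v, v ∈ marked n τ ↔
        Relation.ReflTransGen (StepRel n a (σ.reg 9) (σ.reg 10) (σ.reg 13)) s v := by
  set R := StepRel n a (σ.reg 9) (σ.reg 10) (σ.reg 13) with hR
  -- A round that marks nothing new shows that the marked set is closed. Otherwise it grows, so
  -- without closure `n + 1` vertices would be marked at `j = 0`.
  let Inv : ℕ → State → Prop := fun j τ => τ.reg 18 = j ∧ Same n 18 σ τ ∧ s ∈ marked n τ ∧
    (∀ v ∈ marked n τ, Relation.ReflTransGen R s v) ∧
    ((∀ v, Relation.ReflTransGen R s v → v ∈ marked n τ) ∨ n + 1 ≤ (marked n τ).card + j)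
  refine (Ends.block_seq rfl (Ends.loop (B := 40 * (n * n) + 3) Inv (fun j σ h => h.1) (K := n)
    ?_ ?_)).mono (by simp only [Prog.cost]; linarith)
    (fun τ ⟨_, h2, _, h4, h5⟩ => ⟨h2, fun v => ⟨h4 v, fun hv => ?_⟩⟩)
  · rintro j hj τ ⟨h1, h2, h3, h4, h5⟩
    set τ' := (Prog.sub 18 18 1).eval τ with hτ'
    have hr' : τ'.reg 18 = j := by
      have := h2.reg 1 (by norm_num)
      simp [hτ', Prog.eval, State.setReg, h1, this, h.r1]
    have hs' : Same n 18 τ τ' := ⟨fun x hx => by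
      simp [hτ', Prog.eval, State.setReg, show x ≠ 18 by omega], fun _ _ => rfl⟩
    have hs := h2.trans hs'
    have he := h.same hs (by omega)
    have hmm : marked n τ' = marked n τ := rfl
    have hround := he.round_spec (s := s)
    rw [hs.reg 9 (by omega), hs.reg 10 (by omega), hs.reg 13 (by omega), ← hR, hmm] at hround
    refine (Ends.block_seq (p := .sub 18 18 1) rfl (hround h4)).mono
      (by simp only [Prog.cost]; omega) ?_
    rintro ρ ⟨g1, g2, g3, g4⟩
    refine ⟨(g1.reg 18 (by omega)).trans hr', hs.trans (g1.le (by omega)), g2 h3, g3, ?_⟩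
    by_cases hEq : marked n ρ = marked n τ
    · left
      intro v hv
      induction hv with
      | refl => exact g2 h3
      | tail _ hbc ih => exact g4 _ (hEq ▸ ih) _ hbc
    · rcases h5 with h5 | h5
      · exact .inl fun v hv => g2 (h5 v hv)
      · have := Finset.card_lt_card (g2.ssubset_of_ne (Ne.symm hEq))
        right
        omega
  · simp only [Prog.eval, State.setReg]
    refine ⟨by simp [h.r2], ⟨fun x hx => ?_, fun x hx => rfl⟩, ?_, ?_, .inr ?_⟩
    · simp [show x ≠ 18 by omega]
    · show s ∈ marked n σ
      simp [hσ]
    · show ∀ v ∈ marked n σ, _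
      simp only [hσ, Finset.mem_singleton]
      rintro v rfl
      exact .refl
    · show n + 1 ≤ (marked n σ).card + n
      simp [hσ, add_comm]
  · rcases h5 with h5 | h5
    · exact h5 v hv
    · have : (marked n τ).card ≤ n := by
        simpa [marked] using Finset.card_filter_le (Finset.range n) _
      omega

lemma Env.reach_spec (h : Env n a p σ) (hs : σ.reg 14 < n) :
    Ends reach σ (n * (40 * (n * n) + 8) + 7) fun τ => Same n 18 σ τ ∧ ∀ v < n,
      (τ.mem (4 * (n * n) + 1 + v) ≠ 0 ↔ Relation.ReflTransGen
        (StepRel n a (σ.reg 9) (σ.reg 10) (σ.reg 13)) (σ.reg 14) v) := by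
  refine Ends.mono (Ends.block_seq rfl (.seq ((Env.clear_spec (σ := σ.setReg 21 0)
    (h.same (L := 18) ⟨fun x hx => ?_, fun _ _ => rfl⟩ (by omega)) ?_).mono le_rfl
    (Q' := fun τ => Ends _ τ (n * (40 * (n * n) + 4) + 4) _) ?_)))
    (by simp only [Prog.cost]; linarith) fun τ hτ => hτ
  · simp [State.setReg, show x ≠ 21 by omega]
  · simp [State.setReg]
  rintro τ ⟨h1, h2⟩
  have h3 : Same n 18 σ τ := Same.trans (τ := σ.setReg 21 0) ⟨fun x hx => by
    simp [State.setReg, show x ≠ 21 by omega], fun _ _ => rfl⟩ h1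
  have he := h.same h3 (by omega)
  have h14 := h3.reg 14 (by omega)
  set ρ := (Prog.seq (.add 20 7 14) (.store 20 1)).eval τ with hρ
  have hmem : ρ.mem = Function.update τ.mem (4 * (n * n) + 1 + σ.reg 14) 1 := by
    simp [hρ, Prog.eval, State.setReg, State.setMem, he.r7, he.r1, h14]
  have h4 : Same n 18 τ ρ := by
    refine ⟨fun x hx => ?_, fun x hx => ?_⟩
    · simp [hρ, Prog.eval, State.setReg, State.setMem, show x ≠ 20 by omega]
    · rw [hmem, Function.update_of_ne (by omega)]
  have h5 := h3.trans h4
  have hm : marked n ρ = {σ.reg 14} := by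
    ext v
    simp only [mem_marked, hmem, Function.update_apply, Finset.mem_singleton]
    by_cases hv : v = σ.reg 14
    · simp [hv, hs]
    · simp only [Nat.add_left_cancel_iff, hv, if_false, iff_false, not_and, not_not]
      exact fun hv => h2 v hv
  have hr := (h.same h5 (by omega)).rounds_spec hs hm
  rw [h5.reg 9 (by omega), h5.reg 10 (by omega), h5.reg 13 (by omega)] at hr
  refine (Ends.block_seq rfl hr).mono (by simp only [Prog.cost]; omega) fun τ' ⟨g1, g2⟩ =>
    ⟨h5.trans g1, fun v hv => ?_⟩
  rw [← g2, mem_marked]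
  simp [hv]

/-! ### The program: the test whether an edge is critical -/

/-- After the failure of `f₁` and `f₂`, the slot `e` lies on all paths between the end points of
the slot `q`, which belongs to `p`, and there is one. -/
def Separates (n : ℕ) (a p : ℕ → ℕ) (e f₁ f₂ q : ℕ) : Prop :=
  p q ≠ 0 ∧ Relation.ReflTransGen (StepRel n a f₁ f₂ f₁) (q / n) (q % n) ∧
    ¬ Relation.ReflTransGen (StepRel n a f₁ f₂ e) (q / n) (q % n)

/-- Sets register `12` to `1` if the slots in the registers `8`, …, `11` satisfy `Separates`. -/
def test : Prog :=
  (.add 20 4 11 ;; .load 20 20) ;; .ite 20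
    ((.add 14 5 11 ;; .load 14 14 ;; .add 15 6 11 ;; .load 15 15 ;; .copy 13 9) ;; reach ;;
      (.add 16 7 15 ;; .load 16 16 ;; .copy 13 8) ;; reach ;;
      (.add 17 7 15 ;; .load 17 17 ;; .ite 16 (.ite 17 nop (.const 12 1)) nop)) nop

/-- Register `13` holds the third forbidden slot. The first search repeats `f₁` there, so only two
failures count; the second forbids `e` as well. -/
lemma Env.test_spec (h : Env n a p σ) (hq : σ.reg 11 < n * n) :
    Ends test σ (n * (80 * (n * n) + 16) + 40) fun τ => Same n 12 σ τ ∧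
      (τ.reg 12 ≠ 0 ↔ σ.reg 12 ≠ 0 ∨
        Separates n a p (σ.reg 8) (σ.reg 9) (σ.reg 10) (σ.reg 11)) := by
  have hn : 0 < n := Nat.pos_of_mul_pos_left (by omega : 0 < n * n)
  have hdiv : σ.reg 11 / n < n := Nat.div_lt_of_lt_mul hq
  have hmod : σ.reg 11 % n < n := Nat.mod_lt _ hn
  suffices hsuff : Ends test σ (n * (80 * (n * n) + 16) + 40) fun τ =>
      (∀ x < 4 * (n * n) + 1, τ.mem x = σ.mem x) ∧
      (τ.reg 12 ≠ 0 ↔ σ.reg 12 ≠ 0 ∨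
        Separates n a p (σ.reg 8) (σ.reg 9) (σ.reg 10) (σ.reg 11)) from
    (hsuff.above 12 rfl).mono le_rfl fun τ hτ => ⟨⟨hτ.1, hτ.2.1⟩, hτ.2.2⟩
  set σ₁ := (Prog.seq (.add 20 4 11) (.load 20 20)).eval σ with hσ₁
  have hp : σ₁.reg 20 = p (σ.reg 11) := by
    simp [hσ₁, Prog.eval, State.setReg, h.r4, h.pairs _ hq]
  have s₁ : Same n 18 σ σ₁ := ⟨fun x hx => by
    simp [hσ₁, Prog.eval, State.setReg, show x ≠ 20 by omega], fun _ _ => rfl⟩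
  refine Ends.mono (Ends.block_seq (T := n * (80 * (n * n) + 16) + 38) rfl
    (Ends.mono (Ends.ite (fun h20 => ?_) fun h20 => ?_)
      (T := 1 + (n * (80 * (n * n) + 16) + 37)) (by omega) fun _ => id))
    (by simp only [Prog.cost]; omega) fun _ => id
  swap
  · refine (Ends.block (p := nop) rfl ?_).mono (by simp only [Prog.cost, nop]; omega) fun _ => id
    rw [← hσ₁, hp] at h20
    exact ⟨fun x hx => rfl, by simp [nop, Prog.eval, State.setReg, Separates, h20]⟩
  rw [← hσ₁] at h20 ⊢
  rw [hp] at h20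
  set σ₂ := (Prog.seq (.add 14 5 11) (.seq (.load 14 14) (.seq (.add 15 6 11)
    (.seq (.load 15 15) (.copy 13 9))))).eval σ₁ with hσ₂
  have e₁ := h.same s₁ (by omega)
  have q₁ := s₁.reg 11 (by omega)
  have s₂ : Same n 13 σ σ₂ := (s₁.le (by omega)).trans ⟨fun x hx => by
    simp [hσ₂, Prog.eval, State.setReg, show x ≠ 13 by omega, show x ≠ 14 by omega,
      show x ≠ 15 by omega], fun _ _ => rfl⟩
  have v14 : σ₂.reg 14 = σ.reg 11 / n := by
    simp [hσ₂, Prog.eval, State.setReg, e₁.r5, q₁, e₁.tail _ hq]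
  have v15 : σ₂.reg 15 = σ.reg 11 % n := by
    simp [hσ₂, Prog.eval, State.setReg, e₁.r6, q₁, e₁.head _ hq]
  have v13 : σ₂.reg 13 = σ.reg 9 := by
    simp [hσ₂, Prog.eval, State.setReg, s₁.reg 9]
  have r₂ := (h.same s₂ (by omega)).reach_spec (by rw [v14]; exact hdiv)
  rw [v14, v13, s₂.reg 9 (by omega), s₂.reg 10 (by omega)] at r₂
  refine Ends.mono (Ends.block_seq rfl (.seq (r₂.mono le_rfl (Q' := fun τ => Ends _ τ
    (n * (40 * (n * n) + 8) + 24) _) ?_))) (by simp only [Prog.cost]; linarith) fun _ => id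
  rintro σ₃ ⟨s₃, g₃⟩
  set σ₄ := (Prog.seq (.add 16 7 15) (.seq (.load 16 16) (.copy 13 8))).eval σ₃ with hσ₄
  have e₃ := (h.same s₂ (by omega)).same s₃ (by omega)
  have s₄ : Same n 13 σ₃ σ₄ := ⟨fun x hx => by
    simp [hσ₄, Prog.eval, State.setReg, show x ≠ 13 by omega, show x ≠ 16 by omega],
    fun _ _ => rfl⟩
  have s₄' : Same n 13 σ σ₄ := s₂.trans ((s₃.le (by omega)).trans s₄)
  have w13 : σ₄.reg 13 = σ.reg 8 := by
    simp [hσ₄, Prog.eval, State.setReg, s₃.reg 8, s₂.reg 8]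
  have w14 : σ₄.reg 14 = σ.reg 11 / n := by
    simp [hσ₄, Prog.eval, State.setReg, s₃.reg 14, v14]
  have w15 : σ₄.reg 15 = σ.reg 11 % n := by
    simp [hσ₄, Prog.eval, State.setReg, s₃.reg 15, v15]
  have w16 : σ₄.reg 16 = σ₃.mem (4 * (n * n) + 1 + σ.reg 11 % n) := by
    simp [hσ₄, Prog.eval, State.setReg, e₃.r7, s₃.reg 15, v15]
  have r₄ := (h.same s₄' (by omega)).reach_spec (by rw [w14]; exact hdiv)
  rw [w14, w13, s₄'.reg 9 (by omega), s₄'.reg 10 (by omega)] at r₄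
  refine Ends.mono (Ends.block_seq rfl (.seq (r₄.mono le_rfl (Q' := fun τ => Ends _ τ
    8 _) ?_))) (by simp only [Prog.cost]; linarith) fun _ => id
  rintro σ₅ ⟨s₅, g₅⟩
  have e₅ := (h.same s₄' (by omega)).same s₅ (by omega)
  have k₄ := g₃ _ hmod
  rw [← w16, ← s₅.reg 16 (by omega)] at k₄
  have k₅ := g₅ _ hmod
  refine (Ends.block rfl ?_).mono (by simp [Prog.cost, nop]) fun _ => id
  have hmem : ∀ x < 4 * (n * n) + 1, σ₅.mem x = σ.mem x := (s₄'.trans (s₅.le (by omega))).mem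
  have h12 : σ₅.reg 12 = σ.reg 12 := (s₅.reg 12 (by omega)).trans (s₄'.reg 12 (by omega))
  rw [Separates, ← k₄, ← k₅]
  by_cases c16 : σ₅.reg 16 = 0 <;>
  by_cases c17 : σ₅.mem (4 * (n * n) + 1 + σ.reg 11 % n) = 0 <;>
  · simp [nop, Prog.eval, State.setReg, e₅.r7, s₅.reg 15, w15, c16, c17, h12, h20]
    exact fun x hx => hmem x (by omega)

/-- Runs `q` with all the values below that of the register `m` in the register `i`. -/
def forEx (i m : ℕ) (q : Prog) : Prog := .copy i m ;; .loop i (.sub i i 1 ;; q)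

/-- Register `12` is never reset inside the loops, so it accumulates the disjunction. Each nested
body preserves the counters up to its own `i`. -/
lemma Env.forEx_spec (h : Env n a p σ) {i m K B : ℕ} {q : Prog} (hi : 8 ≤ i) (hi' : i < 12)
    (hm : σ.reg m = K) (Q : ℕ → Prop)
    (hq : ∀ j < K, ∀ τ, Same n i σ τ → τ.reg i = j → Ends q τ B fun ρ => Same n (i + 1) τ ρ ∧
      (ρ.reg 12 ≠ 0 ↔ τ.reg 12 ≠ 0 ∨ Q j)) :
    Ends (forEx i m q) σ (K * (B + 2) + 2) fun τ => Same n i σ τ ∧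
      (τ.reg 12 ≠ 0 ↔ σ.reg 12 ≠ 0 ∨ ∃ j < K, Q j) := by
  let Inv : ℕ → State → Prop := fun j τ => τ.reg i = j ∧ Same n i σ τ ∧
    (τ.reg 12 ≠ 0 ↔ σ.reg 12 ≠ 0 ∨ ∃ j' < K, j ≤ j' ∧ Q j')
  refine (Ends.block_seq rfl (Ends.loop (B := 1 + B) Inv (fun j σ h => h.1) (K := K) ?_ ?_)).mono
    (by simp only [Prog.cost]; linarith) (fun τ ⟨_, h2, h3⟩ => ⟨h2, by simpa using h3⟩)
  · rintro j hj τ ⟨h1, h2, h3⟩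
    have hr : (τ.setReg i (τ.reg i - τ.reg 1)).reg i = j := by
      have := h2.reg 1 (by omega)
      simp [State.setReg, h1, this, h.r1]
    have hs : Same n i τ (τ.setReg i (τ.reg i - τ.reg 1)) :=
      ⟨fun x hx => by simp [State.setReg, show x ≠ i by omega], fun _ _ => rfl⟩
    have h12 : (τ.setReg i (τ.reg i - τ.reg 1)).reg 12 = τ.reg 12 := by
      simp [State.setReg, show 12 ≠ i by omega]
    refine Ends.block_seq (p := .sub i i 1) rfl ((hq j hj _ (h2.trans hs) hr).mono le_rfl ?_)
    rintro ρ ⟨g1, g2⟩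
    refine ⟨(g1.reg i (by omega)).trans hr, (h2.trans hs).trans (g1.le (by omega)), ?_⟩
    rw [g2, h12, h3, or_assoc]
    refine or_congr_right ⟨?_, ?_⟩
    · rintro (⟨j', h1, h2, h3⟩ | hQ)
      · exact ⟨j', h1, by omega, h3⟩
      · exact ⟨j, hj, le_rfl, hQ⟩
    · rintro ⟨j', h1, h2, h3⟩
      rcases eq_or_lt_of_le h2 with rfl | h2
      · exact .inr h3
      · exact .inl ⟨j', h1, h2, h3⟩
  · refine ⟨by simp [Prog.eval, State.setReg, hm], ⟨fun x hx => ?_, fun _ _ => rfl⟩, ?_⟩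
    · simp [Prog.eval, State.setReg, show x ≠ i by omega]
    · have : ¬ ∃ j' < K, K ≤ j' ∧ Q j' := by rintro ⟨j', h1, h2, -⟩; omega
      simp only [Prog.eval, State.setReg, this, or_false]
      rw [Function.update_of_ne (by omega)]

/-- The slot `e` is critical for some pair and at most two failing slots. -/
def SlotCrit (n : ℕ) (a p : ℕ → ℕ) (e : ℕ) : Prop :=
  ∃ f₁ < n * n + 1, ∃ f₂ < n * n + 1, ∃ q < n * n, Separates n a p e f₁ f₂ q

/-- Sets register `12` to `1` if the slot in register `8` is critical. -/
def search : Prog := forEx 9 4 (forEx 10 4 (forEx 11 3 test))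

/-- A bound on the number of steps of `search`. -/
def searchTime (n : ℕ) : ℕ :=
  (n * n + 1) * ((n * n + 1) * (n * n * (n * (80 * (n * n) + 16) + 42) + 4) + 4) + 2

lemma Env.search_spec (h : Env n a p σ) :
    Ends search σ (searchTime n) fun τ => Same n 9 σ τ ∧
      (τ.reg 12 ≠ 0 ↔ σ.reg 12 ≠ 0 ∨ SlotCrit n a p (σ.reg 8)) := by
  refine h.forEx_spec (by omega) (by omega) h.r4 _ fun f₁ hf₁ σ₁ s₁ v₁ => ?_
  have h₁ := h.same s₁ (by omega)
  refine h₁.forEx_spec (by omega) (by omega) h₁.r4 _ fun f₂ hf₂ σ₂ s₂ v₂ => ?_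
  have h₂ := h₁.same s₂ (by omega)
  refine h₂.forEx_spec (by omega) (by omega) h₂.r3 _ fun q hq σ₃ s₃ v₃ => ?_
  have h₃ := h₂.same s₃ (by omega)
  have := h₃.test_spec (by rw [v₃]; exact hq)
  rwa [v₃, s₃.reg 10 (by omega), v₂, s₃.reg 9 (by omega), s₂.reg 9 (by omega), v₁,
    s₃.reg 8 (by omega), s₂.reg 8 (by omega), s₁.reg 8 (by omega)] at this

/-! ### The program: greedy deletion -/

/-- Deletes the slot in register `8` if it is an edge that is not critical. -/
def pruneSlot : Prog :=
  (.add 20 8 1 ;; .load 20 20) ;; .ite 20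
    (.const 12 0 ;; search ;; .ite 12 nop (.add 20 8 1 ;; .const 21 0 ;; .store 20 21)) nop

/-- Deletes edges as long as there are edges that are not critical. -/
def prune : Prog := .copy 8 3 ;; .loop 8 (.sub 8 8 1 ;; pruneSlot)

lemma Env.pruneSlot_spec (h : Env n a p σ) (he : σ.reg 8 < n * n) :
    Ends pruneSlot σ (searchTime n + 8) fun τ => τ.reg 8 = σ.reg 8 ∧
      ((a (σ.reg 8) = 0 ∨ SlotCrit n a p (σ.reg 8)) ∧ Env n a p τ ∨
        (a (σ.reg 8) ≠ 0 ∧ ¬ SlotCrit n a p (σ.reg 8)) ∧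
          Env n (Function.update a (σ.reg 8) 0) p τ) := by
  set σ₁ := (Prog.seq (.add 20 8 1) (.load 20 20)).eval σ with hσ₁
  have ha : σ₁.reg 20 = a (σ.reg 8) := by
    simp [hσ₁, Prog.eval, State.setReg, h.r1, h.graph _ he]
  have s₁ : Same n 12 σ σ₁ := ⟨fun x hx => by
    simp [hσ₁, Prog.eval, State.setReg, show x ≠ 20 by omega], fun _ _ => rfl⟩
  refine Ends.mono (Ends.block_seq (T := searchTime n + 6) rfl
    (Ends.mono (Ends.ite (fun h20 => ?_) fun h20 => ?_)
      (T := 1 + (searchTime n + 5)) (by omega) fun _ => id))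
    (by simp only [Prog.cost]; omega) fun _ => id
  swap
  · refine (Ends.block (p := nop) rfl ?_).mono (by simp only [Prog.cost, nop]; omega) fun _ => id
    rw [← hσ₁, ha] at h20
    have s₂ : Same n 9 σ₁ (nop.eval σ₁) := ⟨fun x hx => by
      simp [nop, Prog.eval, State.setReg, show x ≠ 20 by omega], fun _ _ => rfl⟩
    have s₃ := (s₁.le (by omega)).trans s₂
    exact ⟨s₃.reg 8 (by omega), .inl ⟨.inl h20, h.same s₃ (by omega)⟩⟩
  rw [← hσ₁] at h20 ⊢
  rw [ha] at h20
  have s₂ : Same n 12 σ (σ₁.setReg 12 0) := s₁.trans ⟨fun x hx => by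
    simp [State.setReg, show x ≠ 12 by omega], fun _ _ => rfl⟩
  have hsearch := (h.same s₂ (by omega)).search_spec
  rw [s₂.reg 8 (by omega), show (σ₁.setReg 12 0).reg 12 = 0 by simp [State.setReg]] at hsearch
  refine Ends.mono (Ends.block_seq (p := .const 12 0) rfl (.seq (hsearch.mono le_rfl
    (Q' := fun τ => Ends _ τ 4 _) ?_))) (by simp only [Prog.cost]; omega) fun _ => id
  rintro σ₃ ⟨s₃, g₃⟩
  have s₃' := (s₂.le (by omega)).trans s₃
  have h₃ := h.same s₃' (by omega)
  have v8 := s₃'.reg 8 (by omega)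
  refine Ends.mono (Ends.ite (T := 3) (fun h12 => ?_) fun h12 => ?_) (by omega) fun _ => id
  · refine (Ends.block (p := nop) rfl ?_).mono (by simp [Prog.cost, nop]) fun _ => id
    have s₄ : Same n 9 σ₃ (nop.eval σ₃) := ⟨fun x hx => by
      simp [nop, Prog.eval, State.setReg, show x ≠ 20 by omega], fun _ _ => rfl⟩
    refine ⟨(s₃'.trans s₄).reg 8 (by omega), .inl ⟨.inr ?_, h₃.same s₄ (by omega)⟩⟩
    simpa using g₃.1 h12
  · have hcrit : ¬ SlotCrit n a p (σ.reg 8) := fun hc => g₃.2 (.inr hc) h12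
    refine (Ends.block rfl ?_).mono (by simp [Prog.cost]) fun _ => id
    set ρ := (Prog.seq (.add 20 8 1) (.seq (.const 21 0) (.store 20 21))).eval σ₃ with hρ
    have hreg : ∀ x < 20, ρ.reg x = σ₃.reg x := fun x hx => by
      simp [hρ, Prog.eval, State.setReg, State.setMem, show x ≠ 20 by omega,
        show x ≠ 21 by omega]
    have hmem : ρ.mem = Function.update σ₃.mem (σ.reg 8 + 1) 0 := by
      simp [hρ, Prog.eval, State.setReg, State.setMem, h₃.r1, v8]
    refine ⟨(hreg 8 (by omega)).trans v8, .inr ⟨⟨h20, hcrit⟩, ?_⟩⟩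
    exact {
      r1 := (hreg _ (by omega)).trans h₃.r1
      r2 := (hreg _ (by omega)).trans h₃.r2
      r3 := (hreg _ (by omega)).trans h₃.r3
      r4 := (hreg _ (by omega)).trans h₃.r4
      r5 := (hreg _ (by omega)).trans h₃.r5
      r6 := (hreg _ (by omega)).trans h₃.r6
      r7 := (hreg _ (by omega)).trans h₃.r7
      graph := fun k hk => by
        by_cases hke : k = σ.reg 8
        · simp [hmem, hke]
        · simp [hmem, hke, h₃.graph k hk]
      pairs := fun k hk => by
        rw [hmem, Function.update_of_ne (by omega), h₃.pairs k hk]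
      tail := fun k hk => by
        rw [hmem, Function.update_of_ne (by omega), h₃.tail k hk]
      head := fun k hk => by
        rw [hmem, Function.update_of_ne (by omega), h₃.head k hk] }

lemma Env.prune_spec (h : Env n a p σ) (I : ℕ → (ℕ → ℕ) → Prop) (h0 : I (n * n) a)
    (hkeep : ∀ j < n * n, ∀ a, I (j + 1) a → a j = 0 ∨ SlotCrit n a p j → I j a)
    (hdel : ∀ j < n * n, ∀ a, I (j + 1) a → a j ≠ 0 → ¬ SlotCrit n a p j →
      I j (Function.update a j 0)) :
    Ends prune σ (n * n * (searchTime n + 10) + 2) fun τ => ∃ a', Env n a' p τ ∧ I 0 a' := by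
  refine (Ends.block_seq rfl (Ends.loop (B := 1 + (searchTime n + 8))
    (fun j τ => τ.reg 8 = j ∧ ∃ a', Env n a' p τ ∧ I j a') (fun j σ h => h.1) (K := n * n)
    ?_ ?_)).mono (by simp only [Prog.cost]; linarith) (fun τ ⟨_, h2⟩ => h2)
  · rintro j hj τ ⟨h1, a', h2, h3⟩
    have hs : Same n 8 τ (τ.setReg 8 (τ.reg 8 - τ.reg 1)) :=
      ⟨fun x hx => by simp [State.setReg, show x ≠ 8 by omega], fun _ _ => rfl⟩
    have hr : (τ.setReg 8 (τ.reg 8 - τ.reg 1)).reg 8 = j := by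
      simp [State.setReg, h1, h2.r1]
    have hp := (h2.same hs le_rfl).pruneSlot_spec (by rw [hr]; exact hj)
    rw [hr] at hp
    refine Ends.block_seq (p := .sub 8 8 1) rfl (hp.mono le_rfl ?_)
    rintro ρ ⟨g1, ⟨g2, g3⟩ | ⟨g2, g3⟩⟩
    · exact ⟨g1, a', g3, hkeep j hj a' h3 g2⟩
    · exact ⟨g1, _, g3, hdel j hj a' h3 g2.1 g2.2⟩
  · have hs : Same n 8 σ ((Prog.copy 8 3).eval σ) :=
      ⟨fun x hx => by simp [Prog.eval, State.setReg, show x ≠ 8 by omega], fun _ _ => rfl⟩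
    exact ⟨by simp [Prog.eval, State.setReg, h.r3], a, h.same hs le_rfl, h0⟩

/-! ### The program: input and output -/

/-- Computes `n²` in register `3`. -/
def square : Prog := .copy 18 2 ;; .loop 18 (.sub 18 18 1 ;; .add 3 3 2)

/-- Computes the constants in the registers `1`, …, `7`. -/
def constants : Prog :=
  (.const 1 1 ;; .load 2 20) ;; square ;; .add 4 3 1 ;; .add 5 4 3 ;; .add 6 5 3 ;; .add 7 6 3

/-- Writes the end points of the slots whose tail is in register `18` to the tables. -/
def tableRow : Prog :=
  .copy 20 2 ;; .loop 20 (.sub 20 20 1 ;; .sub 19 19 1 ;; .add 21 5 19 ;; .store 21 18 ;;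
    .add 21 6 19 ;; .store 21 20)

/-- Writes the tables of the end points of the slots. -/
def tables : Prog := (.copy 19 3 ;; .copy 18 2) ;; .loop 18 (.sub 18 18 1 ;; tableRow)

/-- Moves the graph to the beginning of the memory. -/
def output : Prog :=
  (.copy 18 3 ;; .loop 18 (.sub 18 18 1 ;; .sub 20 3 18 ;; .load 21 20 ;; .sub 20 20 1 ;;
    .store 20 21)) ;; .copy 0 3

/-- The program of the theorem. -/
def algorithm : Prog := constants ;; tables ;; prune ;; output

lemma square_spec (h1 : σ.reg 1 = 1) (h2 : σ.reg 2 = n) (h3 : σ.reg 3 = 0) :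
    Ends square σ (n * 3 + 2) fun τ =>
      τ.reg 1 = 1 ∧ τ.reg 2 = n ∧ τ.reg 3 = n * n ∧ τ.mem = σ.mem := by
  refine (Ends.block_seq rfl (Ends.loop (B := 2) (fun j τ => τ.reg 18 = j ∧ τ.reg 1 = 1 ∧
    τ.reg 2 = n ∧ τ.reg 3 + j * n = n * n ∧ τ.mem = σ.mem) (fun j σ h => h.1) (K := n)
    ?_ ?_)).mono (by simp only [Prog.cost]; omega) (fun τ ⟨_, h1, h2, h3, h4⟩ =>
      ⟨h1, h2, by simpa using h3, h4⟩)
  · rintro j hj τ ⟨g1, g2, g3, g4, g5⟩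
    refine (Ends.block rfl ?_).mono (by simp [Prog.cost]) fun _ => id
    refine ⟨?_, ?_, ?_, ?_, g5⟩ <;> simp [Prog.eval, State.setReg, g1, g2, g3]
    linarith
  · simp [Prog.eval, State.setReg, h1, h2, h3]

lemma constants_spec (h0 : σ.mem 0 = n) (h3 : σ.reg 3 = 0) (h20 : σ.reg 20 = 0) :
    Ends constants σ (n * 3 + 8) fun τ => (τ.reg 1 = 1 ∧ τ.reg 2 = n ∧ τ.reg 3 = n * n ∧
      τ.reg 4 = n * n + 1 ∧ τ.reg 5 = 2 * (n * n) + 1 ∧ τ.reg 6 = 3 * (n * n) + 1 ∧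
      τ.reg 7 = 4 * (n * n) + 1) ∧ τ.mem = σ.mem := by
  have hsq := square_spec (n := n) (σ := (Prog.seq (.const 1 1) (.load 2 20)).eval σ)
    (by simp [Prog.eval, State.setReg]) (by simp [Prog.eval, State.setReg, h20, h0])
    (by simp [Prog.eval, State.setReg, h3])
  refine Ends.mono (Ends.block_seq rfl (.seq (hsq.mono le_rfl (Q' := fun τ => Ends _ τ 4 _) ?_)))
    (by simp only [Prog.cost]; omega) fun _ => id
  rintro τ ⟨g1, g2, g3, g4⟩
  refine (Ends.block rfl ?_).mono (by simp [Prog.cost]) fun _ => id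
  refine ⟨?_, g4⟩
  simp [Prog.eval, State.setReg, g1, g2, g3]
  omega

/-- The tables are written from the slot `m` on. The state `σ` is the one before. -/
structure TablesFrom (n m : ℕ) (σ τ : State) : Prop where
  reg : ∀ x < 18, τ.reg x = σ.reg x
  mem : ∀ x < 2 * (n * n) + 1, τ.mem x = σ.mem x
  tail : ∀ k < n * n, m ≤ k → τ.mem (2 * (n * n) + 1 + k) = k / n
  head : ∀ k < n * n, m ≤ k → τ.mem (3 * (n * n) + 1 + k) = k % n

/-- The machine cannot divide. Counting rows and columns down along with the slot `j * n + b` yields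
its quotient `j` and remainder `b` directly. -/
lemma tableRow_spec (h1 : σ.reg 1 = 1) (h2 : σ.reg 2 = n) (h5 : σ.reg 5 = 2 * (n * n) + 1)
    (h6 : σ.reg 6 = 3 * (n * n) + 1) {j : ℕ} (hj : j < n)
    (h : TablesFrom n ((j + 1) * n) σ τ) (h18 : τ.reg 18 = j) (h19 : τ.reg 19 = (j + 1) * n) :
    Ends tableRow τ (n * 7 + 2) fun ρ => TablesFrom n (j * n) σ ρ ∧ ρ.reg 18 = j ∧
      ρ.reg 19 = j * n := by
  refine (Ends.block_seq rfl (Ends.loop (B := 6) (fun b ρ => ρ.reg 20 = b ∧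
    TablesFrom n (j * n + b) σ ρ ∧ ρ.reg 18 = j ∧ ρ.reg 19 = j * n + b) (fun j σ h => h.1)
    (K := n) ?_ ?_)).mono (by simp only [Prog.cost]; omega) (fun τ ⟨_, h1, h2, h3⟩ =>
      ⟨h1, h2, h3⟩)
  · rintro b hb ρ ⟨g1, g2, g3, g4⟩
    have r1 := (g2.reg 1 (by omega)).trans h1
    have r5 := (g2.reg 5 (by omega)).trans h5
    have r6 := (g2.reg 6 (by omega)).trans h6
    have hk : j * n + b < n * n := by nlinarith
    have hdiv : (j * n + b) / n = j := by
      rw [mul_comm, Nat.mul_add_div (by omega), Nat.div_eq_of_lt hb, add_zero]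
    have hmod : (j * n + b) % n = b := by
      rw [mul_comm, Nat.mul_add_mod, Nat.mod_eq_of_lt hb]
    refine (Ends.block rfl ?_).mono (by simp [Prog.cost]) fun _ => id
    set ρ' := Prog.eval _ ρ with hρ'
    have hreg : ∀ x < 19, ρ'.reg x = ρ.reg x := fun x hx => by
      simp [hρ', Prog.eval, State.setReg, State.setMem, show x ≠ 19 by omega,
        show x ≠ 20 by omega, show x ≠ 21 by omega]
    have hmem : ρ'.mem = Function.update (Function.update ρ.mem
        (2 * (n * n) + 1 + (j * n + b)) j) (3 * (n * n) + 1 + (j * n + b)) b := by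
      simp [hρ', Prog.eval, State.setReg, State.setMem, r1, r5, r6, g1, g3, g4, ← add_assoc]
    refine ⟨by simp [hρ', Prog.eval, State.setReg, State.setMem, g1, r1],
      ⟨fun x hx => (hreg x (by omega)).trans (g2.reg x hx), fun x hx => ?_, fun k hk' hjk => ?_,
        fun k hk' hjk => ?_⟩, (hreg 18 (by omega)).trans g3,
      by simp [hρ', Prog.eval, State.setReg, State.setMem, g1, r1, g4, ← add_assoc]⟩
    · rw [hmem, Function.update_of_ne (by omega), Function.update_of_ne (by omega), g2.mem x hx]
    · rw [hmem, Function.update_of_ne (by omega)]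
      rcases eq_or_lt_of_le hjk with rfl | hjk
      · rw [Function.update_self, hdiv]
      · rw [Function.update_of_ne (by omega), g2.tail k hk' (by omega)]
    · rw [hmem]
      rcases eq_or_lt_of_le hjk with rfl | hjk
      · rw [Function.update_self, hmod]
      · rw [Function.update_of_ne (by omega), Function.update_of_ne (by omega),
          g2.head k hk' (by omega)]
  · have r2 := (h.reg 2 (by omega)).trans h2
    rw [Nat.succ_mul] at h h19
    refine ⟨by simp [Prog.eval, State.setReg, r2], ⟨fun x hx => ?_, h.mem, h.tail, h.head⟩,
      by simp [Prog.eval, State.setReg, h18], by simp [Prog.eval, State.setReg, h19]⟩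
    simpa [Prog.eval, State.setReg, show x ≠ 20 by omega] using h.reg x hx

lemma tables_spec (h1 : σ.reg 1 = 1) (h2 : σ.reg 2 = n) (h3 : σ.reg 3 = n * n)
    (h5 : σ.reg 5 = 2 * (n * n) + 1) (h6 : σ.reg 6 = 3 * (n * n) + 1) :
    Ends tables σ (n * (n * 7 + 4) + 3) fun τ => TablesFrom n 0 σ τ := by
  refine (Ends.block_seq rfl (Ends.loop (B := 1 + (n * 7 + 2)) (fun j ρ => ρ.reg 18 = j ∧
    TablesFrom n (j * n) σ ρ ∧ ρ.reg 19 = j * n) (fun j σ h => h.1) (K := n)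
    ?_ ?_)).mono (by simp only [Prog.cost]; linarith) (fun τ hτ => by simpa using hτ.2.1)
  · rintro j hj ρ ⟨g1, g2, g3⟩
    have r1 := (g2.reg 1 (by omega)).trans h1
    refine Ends.block_seq (p := .sub 18 18 1) rfl ((tableRow_spec
      (τ := (Prog.sub 18 18 1).eval ρ) h1 h2 h5 h6 hj ⟨fun x hx => ?_, g2.mem, g2.tail, g2.head⟩ ?_ ?_).mono le_rfl fun τ hτ =>
        ⟨hτ.2.1, hτ.1, hτ.2.2⟩)
    · simpa [Prog.eval, State.setReg, show x ≠ 18 by omega] using g2.reg x hx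
    · simp [Prog.eval, State.setReg, g1, r1]
    · simp [Prog.eval, State.setReg, g3]
  · refine ⟨by simp [Prog.eval, State.setReg, h2], ⟨fun x hx => ?_, fun _ _ => rfl,
      by omega, by omega⟩, by simp [Prog.eval, State.setReg, h3]⟩
    simp [Prog.eval, State.setReg, show x ≠ 18 by omega, show x ≠ 19 by omega]

lemma setup_spec {T : ℕ} {q : Prog} {Q : State → Prop} (h0 : σ.mem 0 = n) (h3 : σ.reg 3 = 0)
    (h20 : σ.reg 20 = 0) (ha : ∀ k < n * n, σ.mem (k + 1) = a k)
    (hp : ∀ k < n * n, σ.mem (n * n + 1 + k) = p k)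
    (hq : ∀ τ, Env n a p τ → Ends q τ T Q) :
    Ends (constants ;; tables ;; q) σ (n * (n * 7 + 7) + 11 + T) Q := by
  refine Ends.mono (.seq ((constants_spec h0 h3 h20).mono le_rfl
    (Q' := fun τ => Ends _ τ (n * (n * 7 + 4) + 3 + T) _) ?_)) (by linarith) fun _ => id
  rintro τ ⟨⟨r1, r2, r3, r4, r5, r6, r7⟩, hm⟩
  refine .seq ((tables_spec r1 r2 r3 r5 r6).mono le_rfl fun ρ hρ => hq ρ ?_)
  exact {
    r1 := (hρ.reg _ (by omega)).trans r1
    r2 := (hρ.reg _ (by omega)).trans r2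
    r3 := (hρ.reg _ (by omega)).trans r3
    r4 := (hρ.reg _ (by omega)).trans r4
    r5 := (hρ.reg _ (by omega)).trans r5
    r6 := (hρ.reg _ (by omega)).trans r6
    r7 := (hρ.reg _ (by omega)).trans r7
    graph := fun k hk => by rw [hρ.mem _ (by omega), hm, ha k hk]
    pairs := fun k hk => by rw [hρ.mem _ (by omega), hm, hp k hk]
    tail := fun k hk => hρ.tail k hk (Nat.zero_le _)
    head := fun k hk => hρ.head k hk (Nat.zero_le _) }

lemma Env.output_spec (h : Env n a p σ) :
    Ends output σ (n * n * 6 + 3) fun τ => τ.output = (List.range (n * n)).map a := by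
  -- The graph moves down by one address, in increasing order, so every cell is read before it is
  -- overwritten.
  refine Ends.mono (.seq ((Ends.block_seq rfl (Ends.loop (B := 5) (fun j τ => τ.reg 18 = j ∧
    j ≤ n * n ∧ τ.reg 1 = 1 ∧ τ.reg 3 = n * n ∧ (∀ k, k + j < n * n → τ.mem k = a k) ∧
    ∀ k < n * n, n * n ≤ k + j → τ.mem (k + 1) = a k) (fun j σ h => h.1)
    (K := n * n) ?_ ?_)).mono le_rfl (Q' := fun τ => Ends _ τ 1 _) ?_))
    (by simp only [Prog.cost]; linarith) fun _ => id
  · rintro j hj τ ⟨g1, -, g2, g3, g4, g5⟩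
    refine (Ends.block rfl ?_).mono (by simp [Prog.cost]) fun _ => id
    set ρ := Prog.eval _ τ with hρ
    have hmem : ρ.mem = Function.update τ.mem (n * n - j - 1) (τ.mem (n * n - j)) := by
      simp [hρ, Prog.eval, State.setReg, State.setMem, g1, g2, g3]
    refine ⟨?_, hj.le, ?_, ?_, fun k hk => ?_, fun k hk hjk => ?_⟩
    · simp [hρ, Prog.eval, State.setReg, State.setMem, g1, g2]
    · simp [hρ, Prog.eval, State.setReg, State.setMem, g2]
    · simp [hρ, Prog.eval, State.setReg, State.setMem, g3]
    · rw [hmem]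
      by_cases hkj : k = n * n - j - 1
      · rw [hkj, Function.update_self, ← g5 _ (by omega) (by omega)]
        congr 1
        omega
      · rw [Function.update_of_ne hkj, g4 k (by omega)]
    · rw [hmem, Function.update_of_ne (by omega), g5 k hk (by omega)]
  · refine ⟨by simp [Prog.eval, State.setReg, h.r3], le_rfl, by simp [Prog.eval, State.setReg, h.r1],
      by simp [Prog.eval, State.setReg, h.r3], by omega, fun k hk _ => h.graph k hk⟩
  · rintro τ ⟨-, -, -, g3, g4, -⟩
    refine (Ends.block rfl ?_).mono (by simp [Prog.cost]) fun _ => id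
    simp only [State.output, Prog.eval, State.setReg, Function.update_self, g3]
    exact List.map_congr_left fun k hk => g4 k (by simpa using hk)

/-! ### Correctness of the program -/

/-- The position of a pair of vertices in a matrix that is written row by row. -/
def slot (e : Fin n × Fin n) : ℕ := e.1 * n + e.2

lemma slot_lt (e : Fin n × Fin n) : slot e < n * n := by
  obtain ⟨⟨u, hu⟩, ⟨v, hv⟩⟩ := e
  simp only [slot]
  nlinarith

lemma slot_div (e : Fin n × Fin n) : slot e / n = e.1 := by
  rw [slot, mul_comm, Nat.mul_add_div (by have := e.1.2; omega), Nat.div_eq_of_lt e.2.2, add_zero]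

lemma slot_mod (e : Fin n × Fin n) : slot e % n = e.2 := by
  rw [slot, mul_comm, Nat.mul_add_mod, Nat.mod_eq_of_lt e.2.2]

lemma slot_injective : Function.Injective (slot (n := n)) := fun e e' h =>
  Prod.ext (Fin.ext (by rw [← slot_div, h, slot_div])) (Fin.ext (by rw [← slot_mod, h, slot_mod]))

lemma exists_slot {k : ℕ} (hk : k < n * n) : ∃ e : Fin n × Fin n, slot e = k := by
  have hn : 0 < n := Nat.pos_of_mul_pos_left (by omega : 0 < n * n)
  refine ⟨(⟨k / n, Nat.div_lt_of_lt_mul hk⟩, ⟨k % n, Nat.mod_lt _ hn⟩), ?_⟩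
  simp only [slot]
  exact Nat.div_add_mod' k n

open Classical in
/-- The 0/1 sequence of a set of pairs of vertices. -/
noncomputable def slotFun (E : Set (Fin n × Fin n)) (k : ℕ) : ℕ :=
  if ∃ e ∈ E, slot e = k then 1 else 0

lemma slotFun_slot_ne_zero {E : Set (Fin n × Fin n)} {e : Fin n × Fin n} :
    slotFun E (slot e) ≠ 0 ↔ e ∈ E := by
  simp [slotFun, slot_injective.eq_iff]

lemma matrixWord_eq (R : Fin n → Fin n → Prop) :
    matrixWord R = (List.range (n * n)).map (slotFun {e | R e.1 e.2}) := by
  classical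
  refine List.ext_getElem (by simp [matrixWord]) fun k h1 h2 => ?_
  have hk : k < n * n := by simpa using h2
  obtain ⟨e, rfl⟩ := exists_slot hk
  have h1 : (⟨slot e, hk⟩ : Fin (n * n)).divNat = e.1 := Fin.ext (slot_div e)
  have h2 : (⟨slot e, hk⟩ : Fin (n * n)).modNat = e.2 := Fin.ext (slot_mod e)
  have h3 : slotFun {e | R e.1 e.2} (slot e) = if R e.1 e.2 then 1 else 0 := by
    simp [slotFun, slot_injective.eq_iff]
  simp only [matrixWord, List.getElem_ofFn, List.getElem_map, List.getElem_range, h3]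
  simp only [h1, h2]

lemma update_slotFun (H : Digraph (Fin n)) (e : Fin n × Fin n) :
    Function.update (slotFun (edges H)) (slot e) 0 = slotFun (edges (deleteEdges H {e})) := by
  funext k
  by_cases hk : k = slot e
  · subst hk
    rw [Function.update_self]
    by_contra hn
    exact (slotFun_slot_ne_zero.1 (Ne.symm hn)).2 rfl
  · rw [Function.update_of_ne hk]
    unfold slotFun
    congr 1
    refine propext (exists_congr fun e' => and_congr_left ?_)
    rintro rfl
    exact ⟨fun h => ⟨h, fun h' => hk (congrArg slot h')⟩, fun h => h.1⟩

lemma stepRel_iff {H : Digraph (Fin n)} {f₁ f₂ f₃ : ℕ} {u : Fin n} {y : ℕ} :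
    StepRel n (slotFun (edges H)) f₁ f₂ f₃ u y ↔ ∃ v : Fin n, (v : ℕ) = y ∧
      (deleteEdges H (slot ⁻¹' {f₁, f₂, f₃})).Adj u v := by
  constructor
  · rintro ⟨k, hk, ⟨h0, h1, h2, h3⟩, hu, rfl⟩
    obtain ⟨⟨u', v⟩, rfl⟩ := exists_slot hk
    rw [slot_div, Fin.val_inj] at hu
    obtain rfl : u' = u := hu
    exact ⟨v, (slot_mod (u', v)).symm, slotFun_slot_ne_zero.1 h0, by simp [h1, h2, h3]⟩
  · rintro ⟨v, rfl, h1, h2⟩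
    refine ⟨slot (u, v), slot_lt _, ⟨slotFun_slot_ne_zero.2 h1, ?_⟩, slot_div _, slot_mod _⟩
    simpa using h2

lemma reflTransGen_stepRel_iff {H : Digraph (Fin n)} {f₁ f₂ f₃ : ℕ} {u v : Fin n} :
    Relation.ReflTransGen (StepRel n (slotFun (edges H)) f₁ f₂ f₃) u v ↔
      Avoid H (slot ⁻¹' {f₁, f₂, f₃}) u v := by
  constructor
  · intro h
    suffices ∀ y : ℕ, Relation.ReflTransGen (StepRel n (slotFun (edges H)) f₁ f₂ f₃) u y →
        ∃ v : Fin n, (v : ℕ) = y ∧ Avoid H (slot ⁻¹' {f₁, f₂, f₃}) u v by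
      obtain ⟨v', hv, h'⟩ := this v h
      rwa [← Fin.val_inj.1 hv]
    intro y hy
    induction hy with
    | refl => exact ⟨u, rfl, .refl⟩
    | tail _ hbc ih =>
      obtain ⟨w, rfl, hw⟩ := ih
      obtain ⟨v, hv, h⟩ := stepRel_iff.1 hbc
      exact ⟨v, hv, hw.tail h⟩
  · exact fun h => Relation.ReflTransGen.lift (fun v : Fin n => (v : ℕ))
      (fun a b hab => stepRel_iff.2 ⟨b, rfl, hab⟩) _ _ h

/-- The value `n * n` is no slot and stands for an absent failure. This is why the failure loops run
over `n * n + 1` values. -/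
lemma exists_eq_preimage_slot {F : Set (Fin n × Fin n)} (hF : F.encard ≤ 2) :
    ∃ f₁ < n * n + 1, ∃ f₂ < n * n + 1, F = slot ⁻¹' {f₁, f₂} := by
  have none : ∀ e : Fin n × Fin n, slot e ≠ n * n := fun e => (slot_lt e).ne
  rcases F.eq_empty_or_nonempty with rfl | ⟨x, hx⟩
  · refine ⟨n * n, by omega, n * n, by omega, ?_⟩
    ext e
    simp [none]
  · have h1 : (F \ {x}).encard ≤ 1 := by
      have h1 := Set.encard_sdiff_singleton_add_one hx
      rw [← h1, show (2 : ℕ∞) = 1 + 1 by norm_num] at hF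
      exact (ENat.add_le_add_iff_right (by simp)).1 hF
    have hxF : F = {x} ∪ F \ {x} := by simpa using (Set.insert_eq_of_mem hx).symm
    have hxl := slot_lt x
    rcases Set.encard_le_one_iff_eq.1 h1 with h | ⟨y, h⟩
    · refine ⟨slot x, by omega, n * n, by omega, ?_⟩
      rw [hxF, h]
      ext e
      simp [none, slot_injective.eq_iff]
    · have hyl := slot_lt y
      refine ⟨slot x, by omega, slot y, by omega, ?_⟩
      rw [hxF, h]
      ext e
      simp [slot_injective.eq_iff, or_comm]

lemma slotCrit_iff {H : Digraph (Fin n)} {P : Set (Fin n × Fin n)} {e : Fin n × Fin n} :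
    SlotCrit n (slotFun (edges H)) (slotFun P) (slot e) ↔ CritFor H P e := by
  have set₁ : ∀ f₁ f₂ : ℕ, ({f₁, f₂, f₁} : Set ℕ) = {f₁, f₂} := fun f₁ f₂ => by
    ext; simp; tauto
  have set₂ : ∀ f₁ f₂ : ℕ, slot ⁻¹' ({f₁, f₂, slot e} : Set ℕ) =
      insert e (slot ⁻¹' {f₁, f₂}) := fun f₁ f₂ => by
    ext; simp [slot_injective.eq_iff]; tauto
  constructor
  · rintro ⟨f₁, -, f₂, -, q, hq, hP, h1, h2⟩
    obtain ⟨x, rfl⟩ := exists_slot hq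
    rw [slot_div, slot_mod, reflTransGen_stepRel_iff] at h1 h2
    rw [set₁] at h1
    rw [set₂] at h2
    refine ⟨x, slotFun_slot_ne_zero.1 hP, slot ⁻¹' {f₁, f₂}, ?_, h1, h2⟩
    rw [← slot_injective.encard_image]
    exact (Set.encard_le_encard (Set.image_preimage_subset _ _)).trans ((Set.encard_insert_le _ _).trans
      (by rw [Set.encard_singleton]; norm_num))
  · rintro ⟨x, hx, F, hF, h1, h2⟩
    obtain ⟨f₁, hf₁, f₂, hf₂, rfl⟩ := exists_eq_preimage_slot hF
    refine ⟨f₁, hf₁, f₂, hf₂, slot x, slot_lt x, slotFun_slot_ne_zero.2 hx, ?_, ?_⟩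
    · rw [slot_div, slot_mod, reflTransGen_stepRel_iff, set₁]
      exact h1
    · rw [slot_div, slot_mod, reflTransGen_stepRel_iff, set₂]
      exact h2

lemma prune_isFTRS {G : Digraph (Fin n)} {P : Set (Fin n × Fin n)} {σ : State}
    (h : Env n (slotFun (edges G)) (slotFun P) σ) :
    Ends prune σ (n * n * (searchTime n + 10) + 2) fun τ => ∃ H : Digraph (Fin n),
      Env n (slotFun (edges H)) (slotFun P) τ ∧ IsFTRS 2 G P H ∧ IsCritical H P := by
  -- The slots from `j` on have been examined. Their surviving edges stay critical under later
  -- deletions by `CritFor.deleteEdges`.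
  refine (h.prune_spec (fun j a => ∃ H : Digraph (Fin n), a = slotFun (edges H) ∧
    IsFTRS 2 G P H ∧ ∀ e ∈ edges H, j ≤ slot e → CritFor H P e) ?_ ?_ ?_).mono le_rfl ?_
  · exact ⟨G, rfl, isFTRS_refl, fun e _ he => absurd (slot_lt e) (by omega)⟩
  · rintro j hj _ ⟨H, rfl, hH, hc⟩ hor
    refine ⟨H, rfl, hH, fun e he hje => ?_⟩
    rcases eq_or_lt_of_le hje with rfl | hje
    · exact slotCrit_iff.1 (hor.resolve_left (slotFun_slot_ne_zero.2 he))
    · exact hc e he hje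
  · rintro j hj _ ⟨H, rfl, hH, hc⟩ - hcrit
    obtain ⟨e, rfl⟩ := exists_slot hj
    rw [slotCrit_iff] at hcrit
    refine ⟨deleteEdges H {e}, update_slotFun H e, hH.deleteEdges hcrit, fun e' he' hje => ?_⟩
    have hne : e' ≠ e := he'.2
    exact (hc e' he'.1 (lt_of_le_of_ne hje
      fun hs => hne (slot_injective hs.symm))).deleteEdges hcrit
  · rintro τ ⟨_, h1, H, rfl, h2, h3⟩
    exact ⟨H, h1, h2, fun e he => h3 e he (Nat.zero_le _)⟩

lemma encode_length (I : Input) : I.encode.length = 2 * (I.n * I.n) + 1 := by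
  simp [Input.encode, matrixWord]
  omega

lemma encode_graph (I : Input) {k : ℕ} (hk : k < I.n * I.n) :
    I.encode.getD (k + 1) 0 = slotFun (edges I.G) k := by
  rw [Input.encode, List.getD_cons_succ, List.getD_append _ _ _ _ (by simpa [matrixWord] using hk),
    matrixWord_eq, List.getD_eq_getElem _ _ (by simpa using hk)]
  simp [edges]

lemma encode_pairs (I : Input) {k : ℕ} (hk : k < I.n * I.n) :
    I.encode.getD (I.n * I.n + 1 + k) 0 = slotFun I.P k := by
  rw [Input.encode, show I.n * I.n + 1 + k = I.n * I.n + k + 1 by omega, List.getD_cons_succ,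
    List.getD_append_right _ _ _ _ (by simp [matrixWord]), matrixWord_eq, matrixWord_eq,
    List.length_map, List.length_range, Nat.add_sub_cancel_left, List.getD_eq_getElem _ _ (by simpa using hk)]
  simp

/-- A bound on the number of steps of `algorithm`. -/
def totalTime (n : ℕ) : ℕ :=
  n * (n * 7 + 7) + 11 + (n * n * (searchTime n + 10) + 2 + (n * n * 6 + 3))

lemma totalTime_mono : Monotone totalTime := by
  intro m n h
  unfold totalTime searchTime
  gcongr

lemma exists_polynomial_totalTime : ∃ f : Polynomial ℕ, ∀ n, f.eval n = totalTime n := by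
  open Polynomial in
  exact ⟨X * (X * 7 + 7) + 11 + (X * X * ((X * X + 1) * ((X * X + 1) *
    (X * X * (X * (80 * (X * X) + 16) + 42) + 4) + 4) + 2 + 10) + 2 + (X * X * 6 + 3)),
    fun n => by simp [totalTime, searchTime]⟩

lemma algorithm_spec (I : Input) :
    Ends algorithm (initState I.encode) (totalTime I.n) fun τ => ∃ H : Digraph (Fin I.n),
      τ.output = matrixWord H.Adj ∧ IsFTRS 2 I.G I.P H ∧ IsCritical H I.P := by
  refine setup_spec (a := slotFun (edges I.G)) (p := slotFun I.P) (by simp [initState, Input.encode])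
    (by simp [initState]) (by simp [initState]) (fun k hk => encode_graph I hk)
    (fun k hk => encode_pairs I hk) fun τ hτ => .seq ((prune_isFTRS hτ).mono le_rfl ?_)
  rintro ρ ⟨H, h1, h2, h3⟩
  exact h1.output_spec.mono le_rfl fun τ' h4 => ⟨H, by rw [h4, matrixWord_eq]; rfl, h2, h3⟩

end FaultTolerant

theorem mainTheorem1 :
    ∃ C : ℝ,
      (∀ (V : Type*) [Fintype V] (G : Digraph V) (P : Set (V × V)),
        ∃ H : Digraph V, FaultTolerant.IsFTRS 2 G P H ∧
          ((FaultTolerant.edges H).ncard : ℝ) ≤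
            C * (Fintype.card V : ℝ) ^ (4 / 3 : ℝ) * (P.ncard : ℝ) ^ (1 / 3 : ℝ)) ∧
      RAM.SolvableInPolyTime FaultTolerant.Input.encode (fun I w =>
        ∃ H : Digraph (Fin I.n), w = FaultTolerant.matrixWord H.Adj ∧
          FaultTolerant.IsFTRS 2 I.G I.P H ∧
          ((FaultTolerant.edges H).ncard : ℝ) ≤
            C * (I.n : ℝ) ^ (4 / 3 : ℝ) * (I.P.ncard : ℝ) ^ (1 / 3 : ℝ)) := by
  refine ⟨38, fun V _ G P => ?_, ?_⟩
  · obtain ⟨H, h1, h2⟩ := FaultTolerant.exists_isFTRS_isCritical G P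
    exact ⟨H, h1, h2.ncard_edges_le⟩
  · obtain ⟨f, hf⟩ := FaultTolerant.exists_polynomial_totalTime
    refine ⟨FaultTolerant.algorithm, f, fun I => ?_⟩
    obtain ⟨T, τ, h1, h2, H, h3, h4, h5⟩ := FaultTolerant.algorithm_spec I
    refine ⟨T, τ, h1, h2.trans ?_, H, h3, h4, by simpa using h5.ncard_edges_le⟩
    -- The time is a polynomial in `n`, and by monotonicity it may be evaluated at the input length
    -- `2 n² + 1 ≥ n`.
    rw [hf, FaultTolerant.encode_length]
    exact FaultTolerant.totalTime_mono (by nlinarith)
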